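/- **Conventions.** Let $\hat{\mathbb C}$ be the Riemann sphere with the spherical distance $d_s$, and $B(y,\delta)$ the spherical ball of center $y$ and radius $\delta$. Let $\mathrm{Poly}$ be the space of non-constant complex polynomials, seen as maps $\hat{\mathbb C}\to\hat{\mathbb C}$, with the metric $\eta(g,h)=\sup_{z\in\hat{\mathbb C}}d_s(g(z),h(z))$, and let $\mathrm{Poly}_{\deg\ge2}$ be the subspace of those of degree at least two. For a non-empty $\Gamma\subset\mathrm{Poly}$, let $\langle\Gamma\rangle$ be the semigroup generated by $\Gamma$ under composition. For a polynomial semigroup $G$ (that is, $G=\langle\Gamma\rangle$ for some such $\Gamma$): * the Fatou set $F(G)$ is the set of points of $\hat{\mathbb C}$ that have a neighborhood on which $G$ is a normal family, and $J(G)=\hat{\mathbb C}\setminus F(G)$ is the Julia set; * $P(G)=\overline{\bigcup_{g\in G}\{\text{critical values of }g:\hat{\mathbb C}\to\hat{\mathbb C}\}}\subset\hat{\mathbb C}$ and $P^*(G)=P(G)\setminus\{\infty\}$; * $\hat K(G)=\{z\in\mathbb C: \{g(z):g\in G\}\text{ is bounded in }\mathbb C\}$; * $G\in\mathcal G$ means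 that each element of $G$ has degree at least two and $P^*(G)$ is bounded in $\mathbb C$; $G\in\mathcal G_{dis}$ means that moreover $J(G)$ is disconnected; * $G$ is hyperbolic if $P(G)\subset F(G)$; * $G$ is semi-hyperbolic if there are $\delta>0$ and $N\in\mathbb N$ such that for all $y\in J(G)$, all $g\in G$ and each connected component $V$ of $g^{-1}(B(y,\delta))$, the degree of the finite branched covering $g:V\to B(y,\delta)$ is at most $N$. **Lemma 5.1.** Let $G=\langle\Gamma\rangle$ be the polynomial semigroup generated by a non-empty compact subset $\Gamma$ of $\mathrm{Poly}_{\deg\ge2}$. Suppose that $G\in\mathcal G$ and $\mathrm{int}(\hat K(G))\ne\emptyset$, and let $b\in\mathrm{int}(\hat K(G))$. Let $d\ge2$ be an integer such that $(d,\deg h)\ne(2,2)$ for each $h\in\Gamma$. Then there exists a number $c>0$ such that for each $a\in\mathbb C$ with $0<|a|<c$ there exists a compact neighborhood $V$ of $g_a(z)=a(z-b)^d+b$ in $\mathrm{Poly}_{\deg\ge2}$ such that for every non-empty subset $V'$ of $V$: 1. $\langle\Gamma\cup V'\rangle\in\mathcal G_{dis}$ and $\hat K(\langle\Gamma\cup V'\rangle)=\hat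 K(G)$; 2. if $G$ is semi-hyperbolic, then $\langle\Gamma\cup V'\rangle$ is semi-hyperbolic; 3. if $G$ is hyperbolic, then $\langle\Gamma\cup V'\rangle$ is hyperbolic. -/

import Mathlib

open scoped Polynomial Topology OnePoint

noncomputable section

namespace PolySemigroup

/-- The Riemann sphere. -/
abbrev Sphere : Type := OnePoint ℂ

/-- Half of the chordal distance on the Riemann sphere (the sphere having radius one). -/
def halfChord : Sphere → Sphere → ℝ
  | ∞, ∞ => 0
  | ∞, OnePoint.some w => 1 / √(1 + ‖w‖ ^ 2)
  | OnePoint.some z, ∞ => 1 / √(1 + ‖z‖ ^ 2)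
  | OnePoint.some z, OnePoint.some w => ‖z - w‖ / (√(1 + ‖z‖ ^ 2) * √(1 + ‖w‖ ^ 2))

/-- The spherical (great circle) distance on the Riemann sphere; it takes values in `[0, π]`. -/
def sphericalDist (x y : Sphere) : ℝ := 2 * Real.arcsin (halfChord x y)

/-- The ball `B(y, δ)` with respect to the spherical distance. -/
def sphericalBall (y : Sphere) (δ : ℝ) : Set Sphere := {x | sphericalDist x y < δ}

/-- The non-constant complex polynomials. -/
@[ext] structure Poly where
  toPolynomial : ℂ[X]
  natDegree_pos : 0 < toPolynomial.natDegree

namespace Poly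

/-- The degree of a non-constant polynomial. -/
def degree (g : Poly) : ℕ := g.toPolynomial.natDegree

/-- A polynomial as a map of the plane. -/
def eval (g : Poly) (z : ℂ) : ℂ := g.toPolynomial.eval z

/-- A non-constant polynomial as a map of the Riemann sphere, with `∞ ↦ ∞`. -/
def sphereMap (g : Poly) : Sphere → Sphere := OnePoint.map g.eval

/-- Non-constant polynomials form a semigroup under composition: `g * h` is `g ∘ h`. -/
instance : Semigroup Poly where
  mul g h := ⟨g.toPolynomial.comp h.toPolynomial, by
    rw [Polynomial.natDegree_comp]
    exact Nat.mul_pos g.natDegree_pos h.natDegree_pos⟩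
  mul_assoc f g h := Poly.ext (Polynomial.comp_assoc _ _ _)

/-- The uniform distance `η(g, h) = sup_z d(g(z), h(z))`, `d` the spherical distance. -/
def unifDist (g h : Poly) : ℝ := ⨆ z : Sphere, sphericalDist (g.sphereMap z) (h.sphereMap z)

/-- The topology of the metric `unifDist`. -/
instance : TopologicalSpace Poly where
  IsOpen U := ∀ g ∈ U, ∃ ε > 0, ∀ h : Poly, unifDist g h < ε → h ∈ U
  isOpen_univ := fun _ _ => ⟨1, one_pos, fun _ _ => trivial⟩
  isOpen_inter := by
    rintro U W hU hW g ⟨hgU, hgW⟩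
    obtain ⟨ε₁, h₁, H₁⟩ := hU g hgU
    obtain ⟨ε₂, h₂, H₂⟩ := hW g hgW
    exact ⟨min ε₁ ε₂, lt_min h₁ h₂, fun h hh =>
      ⟨H₁ h (hh.trans_le (min_le_left _ _)), H₂ h (hh.trans_le (min_le_right _ _))⟩⟩
  isOpen_sUnion := by
    rintro S hS g ⟨U, hU, hgU⟩
    obtain ⟨ε, hε, H⟩ := hS U hU g hgU
    exact ⟨ε, hε, fun h hh => ⟨U, hU, H h hh⟩⟩

/-- The critical values of a non-constant polynomial, as a map of the Riemann sphere. The point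
`∞` is a critical point (hence a critical value) exactly when the degree is at least two. -/
def criticalValues (g : Poly) : Set Sphere :=
  {w | (∃ z : ℂ, g.toPolynomial.derivative.eval z = 0 ∧ w = (g.eval z : Sphere)) ∨
    (w = ∞ ∧ 2 ≤ g.degree)}

end Poly

/-- The non-constant polynomials of degree at least two. -/
def polyDegGeTwo : Set Poly := {g | 2 ≤ g.degree}

/-- The polynomial `z ↦ a (z - b) ^ d + b`. -/
def powerMap (a b : ℂ) (d : ℕ) (ha : a ≠ 0) (hd : 2 ≤ d) : Poly where
  toPolynomial := Polynomial.C a * (Polynomial.X - Polynomial.C b) ^ d + Polynomial.C b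
  natDegree_pos := by
    rw [Polynomial.natDegree_add_C, Polynomial.natDegree_C_mul ha, Polynomial.natDegree_pow,
      Polynomial.natDegree_X_sub_C]
    omega

/-- The polynomial semigroup `⟨Γ⟩` generated by a family `Γ` of non-constant polynomials. -/
abbrev generated (Γ : Set Poly) : Subsemigroup Poly := Subsemigroup.closure Γ

/-- `G` is a normal family on the open set `U`: every sequence in `G` has a subsequence which
converges, uniformly on compact subsets of `U`, with respect to the spherical distance. -/
def IsNormalOn (G : Subsemigroup Poly) (U : Set Sphere) : Prop :=
  ∀ f : ℕ → Poly, (∀ n, f n ∈ G) →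
    ∃ (k : ℕ → ℕ) (φ : Sphere → Sphere), StrictMono k ∧
      ∀ K ⊆ U, IsCompact K → ∀ ε > 0, ∀ᶠ n in Filter.atTop,
        ∀ z ∈ K, sphericalDist ((f (k n)).sphereMap z) (φ z) < ε

/-- The Fatou set `F(G)`. -/
def fatouSet (G : Subsemigroup Poly) : Set Sphere :=
  {z | ∃ U : Set Sphere, IsOpen U ∧ z ∈ U ∧ IsNormalOn G U}

/-- The Julia set `J(G)`. -/
def juliaSet (G : Subsemigroup Poly) : Set Sphere := (fatouSet G)ᶜ

/-- The postcritical set `P(G)`, the closure being taken in the Riemann sphere. -/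
def postcriticalSet (G : Subsemigroup Poly) : Set Sphere :=
  closure (⋃ g ∈ G, g.criticalValues)

/-- The planar postcritical set `P*(G) = P(G) \ {∞}`, as a subset of the plane. -/
def planarPostcriticalSet (G : Subsemigroup Poly) : Set ℂ :=
  {z | (z : Sphere) ∈ postcriticalSet G}

/-- The smallest filled-in Julia set of `G`: the points of the plane with bounded `G`-orbit. -/
def smallestFilledJulia (G : Subsemigroup Poly) : Set ℂ :=
  {z | Bornology.IsBounded {w : ℂ | ∃ g ∈ G, w = g.eval z}}

/-- The class of postcritically bounded polynomial semigroups, all of whose elements have degree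
at least two. -/
def IsPostcriticallyBounded (G : Subsemigroup Poly) : Prop :=
  (∀ g ∈ G, 2 ≤ g.degree) ∧ Bornology.IsBounded (planarPostcriticalSet G)

/-- The semigroups of that class whose Julia set is disconnected. -/
def IsPostcriticallyBoundedDis (G : Subsemigroup Poly) : Prop :=
  IsPostcriticallyBounded G ∧ ¬ IsPreconnected (juliaSet G)

/-- `G` is hyperbolic: `P(G) ⊆ F(G)`. -/
def IsHyperbolic (G : Subsemigroup Poly) : Prop := postcriticalSet G ⊆ fatouSet G

/-- The degree of the finite branched covering `g : V → W`: the number of points of `V` over a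
generic point of `W`, which is the largest number of points of `V` over a point of `W` (a fibre
over a branch value is smaller). -/
def coveringDegree (g : Poly) (V W : Set Sphere) : ℕ∞ :=
  ⨆ w ∈ W, (V ∩ g.sphereMap ⁻¹' {w}).encard

/-- `G` is semi-hyperbolic: for some `δ > 0` and `N`, every element `g` of `G` maps every connected
component `V` of `g⁻¹(B(y, δ))`, `y ∈ J(G)`, onto `B(y, δ)` with degree at most `N`. -/
def IsSemiHyperbolic (G : Subsemigroup Poly) : Prop :=
  ∃ δ > 0, ∃ N : ℕ, ∀ y ∈ juliaSet G, ∀ g ∈ G,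
    ∀ x ∈ g.sphereMap ⁻¹' sphericalBall y δ,
      coveringDegree g (connectedComponentIn (g.sphereMap ⁻¹' sphericalBall y δ) x)
        (sphericalBall y δ) ≤ N

end PolySemigroup

end

/-!
Write `G = ⟨Γ⟩`, `H = ⟨Γ ∪ V'⟩` and `K` for the smallest filled-in Julia set of `G`, and measure
distances from `b`. If `|a|` is small, the map `a (z - b) ^ d + b` is close to `b` on a disc of
radius `M₂` which is much larger than `K`, and expands only outside a still larger disc of radius
`R`. The degree condition is what makes the preimages of the disc of radius `R` under the elements
of `Γ` lie in a disc of radius `M₁ < M₂` (`exists_scales`). All this persists for maps with nearby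
coefficients, and in the space of polynomials nearness of coefficients, at constant degree, is
nearness in the uniform spherical distance (`Poly.coeffNhd_mem_nhds`, `Poly.isCompact_coeffNhd`).
`IsSqueezingExtension` records the resulting configuration.

Elements of `V'` map `K` into a small disc about `b` inside `K`, so `K` is `H`-invariant; it is the
smallest filled-in Julia set of `H`, it contains the finite critical values of `H`, and its interior
is in the Fatou set of `H`. Each element of `H` maps the ring `M₁ < |z - b| < M₂` into `K` or
outside the disc of radius `R`, so the ring lies in the Fatou set, and it separates points of the
Julia set of `H`.

Hyperbolicity and semi-hyperbolicity rest on two facts about preimages of discs. Over a disc without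
critical values a polynomial is injective on connected sets, since the disc is simply connected
(`Poly.injOn_of_disjoint_planeCriticalValues`). Over a disc where the degree is at most `N`,
components of preimages of a smaller disc are uniformly small, by the minimum principle
(`exists_radius_preimage_small`). A small component near `b` would lie in `K` together with its
image; hence over discs centred outside the interior of `K` the components of the preimages under
`p ∈ G` stay away from `b` (`IsSqueezingExtension.exists_radius`). In the hyperbolic case this keeps
the `G`-orbit of the disc about `b` away from the boundary of `K`. In the semi-hyperbolic case
consider a word `p ∘ q` with `p ∈ G` and `q` beginning with a letter of `V'`: the critical values of
`q` are near `b`, so `q` is injective on the components and only `p` contributes to the degree.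

A family of polynomials is shown to be normal through the Arzelà–Ascoli theorem, equicontinuity
coming from the Schwarz lemma, applied to the maps or to their inverses `1 / f`. The chordal metric,
which is the Euclidean one after stereographic projection, replaces the spherical distance, to
which it is comparable.
-/

namespace PolySemigroup

/-! ### The chordal metric -/

/-- Inverse stereographic projection onto the sphere of diameter one in `ℂ × ℝ`. -/
noncomputable def chordEmb : Sphere → WithLp 2 (ℂ × ℝ)
  | ∞ => WithLp.toLp 2 (0, 0)
  | OnePoint.some z => WithLp.toLp 2 (z / ((1 + ‖z‖ ^ 2 : ℝ) : ℂ), 1 / (1 + ‖z‖ ^ 2))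

theorem chordEmb_infty : chordEmb ∞ = WithLp.toLp 2 (0, 0) := rfl

theorem chordEmb_coe (z : ℂ) : chordEmb (z : Sphere) =
    WithLp.toLp 2 (z / ((1 + ‖z‖ ^ 2 : ℝ) : ℂ), 1 / (1 + ‖z‖ ^ 2)) := rfl

theorem halfChord_infty_infty : halfChord ∞ ∞ = 0 := rfl

theorem halfChord_infty_coe (w : ℂ) : halfChord ∞ (w : Sphere) = 1 / √(1 + ‖w‖ ^ 2) := rfl

theorem halfChord_coe_infty (w : ℂ) : halfChord (w : Sphere) ∞ = 1 / √(1 + ‖w‖ ^ 2) := rfl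

theorem halfChord_coe_coe (z w : ℂ) : halfChord (z : Sphere) (w : Sphere) =
    ‖z - w‖ / (√(1 + ‖z‖ ^ 2) * √(1 + ‖w‖ ^ 2)) := rfl

theorem norm_chordEmb_coe_sq (w : ℂ) :
    ‖w / ((1 + ‖w‖ ^ 2 : ℝ) : ℂ)‖ ^ 2 + (1 / (1 + ‖w‖ ^ 2)) ^ 2 = 1 / (1 + ‖w‖ ^ 2) := by
  have h : (0 : ℝ) < 1 + ‖w‖ ^ 2 := by positivity
  rw [norm_div, Complex.norm_real, Real.norm_of_nonneg h.le]
  field_simp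
  ring

/-- The chord is the Euclidean distance of the stereographic images. -/
theorem halfChord_eq_dist (x y : Sphere) : halfChord x y = dist (chordEmb x) (chordEmb y) := by
  rw [WithLp.prod_dist_eq_of_L2]
  induction x using OnePoint.rec <;> induction y using OnePoint.rec
  · simp [chordEmb_infty, halfChord_infty_infty]
  · rename_i w
    rw [chordEmb_infty, chordEmb_coe, halfChord_infty_coe, WithLp.toLp_fst, WithLp.toLp_snd,
      WithLp.toLp_fst, WithLp.toLp_snd, dist_zero_left, dist_zero_left,
      Real.norm_eq_abs, sq_abs, norm_chordEmb_coe_sq, Real.sqrt_div zero_le_one, Real.sqrt_one]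
  · rename_i w
    rw [chordEmb_infty, chordEmb_coe, halfChord_coe_infty, WithLp.toLp_fst, WithLp.toLp_snd,
      WithLp.toLp_fst, WithLp.toLp_snd, dist_zero_right, dist_zero_right,
      Real.norm_eq_abs, sq_abs, norm_chordEmb_coe_sq, Real.sqrt_div zero_le_one, Real.sqrt_one]
  · rename_i z w
    have hz : (0 : ℝ) < 1 + ‖z‖ ^ 2 := by positivity
    have hw : (0 : ℝ) < 1 + ‖w‖ ^ 2 := by positivity
    rw [chordEmb_coe, chordEmb_coe, halfChord_coe_coe, eq_comm, Real.sqrt_eq_iff_mul_self_eq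
      (by positivity) (by positivity)]
    simp only [WithLp.toLp_fst, WithLp.toLp_snd, dist_eq_norm, Real.norm_eq_abs, sq_abs]
    have e1 : z / ((1 + ‖z‖ ^ 2 : ℝ) : ℂ) - w / ((1 + ‖w‖ ^ 2 : ℝ) : ℂ) =
        ((1 / (1 + ‖z‖ ^ 2) : ℝ) : ℂ) * z - ((1 / (1 + ‖w‖ ^ 2) : ℝ) : ℂ) * w := by
      push_cast; ring
    have e2 : ‖z - w‖ / (√(1 + ‖z‖ ^ 2) * √(1 + ‖w‖ ^ 2)) *
        (‖z - w‖ / (√(1 + ‖z‖ ^ 2) * √(1 + ‖w‖ ^ 2))) =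
        ‖z - w‖ ^ 2 / ((1 + ‖z‖ ^ 2) * (1 + ‖w‖ ^ 2)) := by
      rw [div_mul_div_comm, mul_mul_mul_comm, Real.mul_self_sqrt hz.le, Real.mul_self_sqrt hw.le,
        ← sq]
    rw [e1, e2]
    have n (u : ℂ) : ‖u‖ ^ 2 = u.re ^ 2 + u.im ^ 2 := by
      rw [← Complex.normSq_eq_norm_sq, Complex.normSq_apply]; ring
    rw [n (z - w), n (_ - _), n z, n w] at *
    simp only [Complex.sub_re, Complex.sub_im, Complex.re_ofReal_mul, Complex.im_ofReal_mul]
    field_simp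
    ring

theorem halfChord_comm (x y : Sphere) : halfChord x y = halfChord y x := by
  rw [halfChord_eq_dist, halfChord_eq_dist, dist_comm]

theorem halfChord_self (x : Sphere) : halfChord x x = 0 := by
  rw [halfChord_eq_dist, dist_self]

theorem halfChord_nonneg (x y : Sphere) : 0 ≤ halfChord x y := by
  rw [halfChord_eq_dist]; exact dist_nonneg

theorem halfChord_triangle (x y z : Sphere) :
    halfChord x z ≤ halfChord x y + halfChord y z := by
  simp only [halfChord_eq_dist]; exact dist_triangle _ _ _

theorem one_le_sqrt_one_add_sq (t : ℝ) : 1 ≤ √(1 + t ^ 2) :=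
  Real.one_le_sqrt.2 (by nlinarith [sq_nonneg t])

theorem le_sqrt_one_add_sq (t : ℝ) : t ≤ √(1 + t ^ 2) :=
  Real.le_sqrt_of_sq_le (by linarith)

theorem halfChord_coe_coe_le (z w : ℂ) : halfChord (z : Sphere) (w : Sphere) ≤ ‖z - w‖ := by
  rw [halfChord_coe_coe]
  exact div_le_self (norm_nonneg _)
    (one_le_mul_of_one_le_of_one_le (one_le_sqrt_one_add_sq _) (one_le_sqrt_one_add_sq _))

theorem halfChord_coe_infty_le {z : ℂ} {m : ℝ} (hm : 0 < m) (hz : m ≤ ‖z‖) :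
    halfChord (z : Sphere) ∞ ≤ 1 / m := by
  rw [halfChord_coe_infty]
  exact one_div_le_one_div_of_le hm (hz.trans (le_sqrt_one_add_sq _))

/-- Inversion is an isometry of the chordal metric; in particular the chord is bounded by the
distance of the inverses. -/
theorem halfChord_coe_coe_le_inv {z w : ℂ} (hz : z ≠ 0) (hw : w ≠ 0) :
    halfChord (z : Sphere) (w : Sphere) ≤ ‖z⁻¹ - w⁻¹‖ := by
  rw [halfChord_coe_coe, inv_sub_inv hz hw, norm_div, norm_mul, norm_sub_rev w z]
  have := norm_pos_iff.2 hz
  have := norm_pos_iff.2 hw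
  gcongr <;> exact le_sqrt_one_add_sq _

theorem halfChord_le_one (x y : Sphere) : halfChord x y ≤ 1 := by
  induction x using OnePoint.rec <;> induction y using OnePoint.rec
  · simp [halfChord_infty_infty]
  · rw [halfChord_infty_coe]
    exact div_le_one_of_le₀ (one_le_sqrt_one_add_sq _) (Real.sqrt_nonneg _)
  · rw [halfChord_coe_infty]
    exact div_le_one_of_le₀ (one_le_sqrt_one_add_sq _) (Real.sqrt_nonneg _)
  · rename_i z w
    rw [halfChord_coe_coe]
    refine div_le_one_of_le₀ ((norm_sub_le _ _).trans ?_) (by positivity)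
    rw [← Real.sqrt_mul (by positivity)]
    refine Real.le_sqrt_of_sq_le ?_
    nlinarith [sq_nonneg (‖z‖ * ‖w‖ - 1)]

theorem two_mul_halfChord_le (x y : Sphere) : 2 * halfChord x y ≤ sphericalDist x y := by
  unfold sphericalDist
  have h0 := halfChord_nonneg x y
  have h1 := halfChord_le_one x y
  have h2 := Real.sin_le (Real.arcsin_nonneg.2 h0)
  rw [Real.sin_arcsin (by linarith) h1] at h2
  linarith

theorem sphericalDist_le_pi_mul (x y : Sphere) : sphericalDist x y ≤ Real.pi * halfChord x y := by
  unfold sphericalDist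
  have h0 := halfChord_nonneg x y
  have h1 := halfChord_le_one x y
  have h2 := Real.mul_le_sin (Real.arcsin_nonneg.2 h0) (Real.arcsin_le_pi_div_two _)
  rw [Real.sin_arcsin (by linarith) h1] at h2
  have h3 := Real.pi_pos
  rw [div_mul_eq_mul_div, div_le_iff₀ h3] at h2
  linarith

/-- A point which is chordally close to a bounded one is close to it in the plane. -/
theorem norm_sub_le_of_halfChord_lt {z w : ℂ} {M ε : ℝ} (hw : ‖w‖ ≤ M)
    (hε : ε * √(1 + M ^ 2) ≤ 1 / 2) (h : halfChord (w : Sphere) (z : Sphere) < ε) :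
    ‖z - w‖ ≤ 2 * ε * (1 + M ^ 2) := by
  rw [halfChord_comm, halfChord_coe_coe, div_lt_iff₀ (by positivity)] at h
  have hM : 0 ≤ M := (norm_nonneg w).trans hw
  set s := √(1 + M ^ 2)
  have hs : s * s = 1 + M ^ 2 := Real.mul_self_sqrt (by positivity)
  have hs0 : 1 ≤ s := one_le_sqrt_one_add_sq M
  have hε0 : 0 < ε := by
    by_contra hc
    have : ε * (√(1 + ‖z‖ ^ 2) * √(1 + ‖w‖ ^ 2)) ≤ 0 :=
      mul_nonpos_of_nonpos_of_nonneg (not_lt.1 hc) (by positivity)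
    linarith [norm_nonneg (z - w)]
  have h1 : √(1 + ‖w‖ ^ 2) ≤ s := Real.sqrt_le_sqrt (by gcongr)
  have h2 : √(1 + ‖z‖ ^ 2) ≤ s + ‖z - w‖ := by
    rw [Real.sqrt_le_left (by positivity)]
    have h3 : ‖z‖ ≤ M + ‖z - w‖ := by
      have := norm_add_le w (z - w)
      rw [add_sub_cancel] at this
      linarith
    have h4 : ‖z‖ ^ 2 ≤ (M + ‖z - w‖) ^ 2 := by gcongr
    have h5 : M ≤ s := le_sqrt_one_add_sq M
    nlinarith [norm_nonneg (z - w)]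
  have h3 : ‖z - w‖ < ε * ((s + ‖z - w‖) * s) := by
    refine h.trans_le ?_
    gcongr
  nlinarith [norm_nonneg (z - w)]

theorem continuous_chordEmb : Continuous chordEmb := by
  rw [continuous_iff_continuousAt]
  intro x
  induction x using OnePoint.rec
  · rw [Metric.continuousAt_iff']
    intro ε hε
    rw [OnePoint.nhds_infty_eq, Filter.eventually_sup, Filter.eventually_map]
    refine ⟨?_, by simpa using hε⟩
    rw [Filter.coclosedCompact_eq_cocompact]
    filter_upwards [(tendsto_norm_cocompact_atTop (E := ℂ)).eventually_gt_atTop (1 / ε)] with z hz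
    rw [← halfChord_eq_dist]
    have h0 : 0 < 1 / ε := by positivity
    refine (halfChord_coe_infty_le (h0.trans hz) le_rfl).trans_lt ?_
    rwa [one_div_lt (h0.trans hz) hε]
  · rw [OnePoint.continuousAt_coe, Metric.continuousAt_iff']
    intro ε hε
    filter_upwards [Metric.ball_mem_nhds _ hε] with z hz
    simp only [Function.comp, ← halfChord_eq_dist]
    exact (halfChord_coe_coe_le _ _).trans_lt (by simpa [dist_eq_norm] using hz)

open Filter Metric

/-! ### Normal families and the Fatou set -/

/-- A sequence of maps of the sphere which is equicontinuous at the points of an open set has a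
subsequence converging uniformly on the compact subsets of that set. -/
theorem exists_subseq_of_equicontinuousAt (f : ℕ → Sphere → Sphere) {U : Set Sphere}
    (hU : IsOpen U) (hf : ∀ z ∈ U, EquicontinuousAt (fun n x => chordEmb (f n x)) z) :
    ∃ (k : ℕ → ℕ) (φ : Sphere → Sphere), StrictMono k ∧ ∀ K ⊆ U, IsCompact K → ∀ ε > 0,
      ∀ᶠ n in atTop, ∀ z ∈ K, halfChord (f (k n) z) (φ z) < ε := by
  have hT : IsCompact (Set.range chordEmb) := isCompact_range continuous_chordEmb
  let u : ℕ → ℕ → WithLp 2 (ℂ × ℝ) :=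
    fun n j => chordEmb (f n (TopologicalSpace.denseSeq ℂ j : Sphere))
  obtain ⟨l, -, k, hk, hlim⟩ := (isCompact_univ_pi fun _ : ℕ => hT).tendsto_subseq
    (x := u) (fun n j _ => ⟨_, rfl⟩)
  have hdense : ∀ W : Set Sphere, IsOpen W → W.Nonempty →
      ∃ j, (TopologicalSpace.denseSeq ℂ j : Sphere) ∈ W := by
    intro W hW hne
    have h1 : DenseRange ((↑) : ℂ → Sphere) := OnePoint.denseRange_coe
    have h2 := h1.comp (TopologicalSpace.denseRange_denseSeq ℂ) OnePoint.continuous_coe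
    exact h2.exists_mem_open hW hne
  -- On `U`, the subsequence converges pointwise.
  have hpt : ∀ z ∈ U, ∃ y : Sphere,
      Tendsto (fun n => chordEmb (f (k n) z)) atTop (𝓝 (chordEmb y)) := by
    intro z hz
    have hc : CauchySeq (fun n => chordEmb (f (k n) z)) := by
      rw [Metric.cauchySeq_iff']
      intro ε hε
      have h1 := Metric.equicontinuousAt_iff_right.1 (hf z hz) (ε / 4) (by linarith)
      obtain ⟨W, hW, hWo, hzW⟩ := eventually_nhds_iff.1 h1
      obtain ⟨j, hj⟩ := hdense W hWo ⟨z, hzW⟩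
      have h2 := ((tendsto_pi_nhds.1 hlim j).cauchySeq)
      obtain ⟨N, hN⟩ := Metric.cauchySeq_iff'.1 h2 (ε / 4) (by linarith)
      refine ⟨N, fun n hn => ?_⟩
      have a1 := hW _ hj (k n)
      have a2 := hW _ hj (k N)
      have a3 := hN n hn
      simp only [Function.comp, u] at a3
      have a4 := dist_triangle4 (chordEmb (f (k n) z))
        (chordEmb (f (k n) (TopologicalSpace.denseSeq ℂ j : Sphere)))
        (chordEmb (f (k N) (TopologicalSpace.denseSeq ℂ j : Sphere))) (chordEmb (f (k N) z))
      rw [dist_comm] at a2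
      linarith
    obtain ⟨y, ⟨x, rfl⟩, hy⟩ := cauchySeq_tendsto_of_isComplete hT.isComplete
      (fun n => ⟨_, rfl⟩) hc
    exact ⟨x, hy⟩
  choose! φ hφ using hpt
  refine ⟨k, φ, hk, fun K hK hKc ε hε => ?_⟩
  refine hKc.induction_on (p := fun s => ∀ᶠ n in atTop, ∀ z ∈ s, halfChord (f (k n) z) (φ z) < ε)
    (by simp) (fun s t hst ht => ht.mono fun n hn z hz => hn z (hst hz))
    (fun s t hs ht => (hs.and ht).mono fun n hn z hz => hz.elim (hn.1 z) (hn.2 z)) ?_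
  intro z hz
  have h1 := Metric.equicontinuousAt_iff_right.1 (hf z (hK hz)) (ε / 4) (by linarith)
  refine ⟨_, inter_mem_nhdsWithin K (inter_mem h1 (hU.mem_nhds (hK hz))), ?_⟩
  have h2 := (Metric.tendsto_nhds.1 (hφ z (hK hz)) (ε / 4) (by linarith))
  filter_upwards [h2] with n hn x hx
  have h3 : dist (chordEmb (φ z)) (chordEmb (φ x)) ≤ ε / 4 :=
    le_of_tendsto ((hφ z (hK hz)).dist (hφ x hx.2.2))
      (Eventually.of_forall fun m => (hx.2.1 (k m)).le)
  rw [halfChord_eq_dist]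
  have a1 := hx.2.1 (k n)
  have a4 := dist_triangle4 (chordEmb (f (k n) x)) (chordEmb (f (k n) z)) (chordEmb (φ z))
    (chordEmb (φ x))
  rw [dist_comm] at a1
  linarith

theorem isNormalOn_of_subseq (G : Subsemigroup Poly) {U : Set Sphere} (hU : IsOpen U)
    (h : ∀ f : ℕ → Poly, (∀ n, f n ∈ G) → ∃ k : ℕ → ℕ, StrictMono k ∧
      ∀ z ∈ U, EquicontinuousAt (fun n x => chordEmb ((f (k n)).sphereMap x)) z) :
    IsNormalOn G U := by
  intro f hf
  obtain ⟨k, hk, hk'⟩ := h f hf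
  obtain ⟨l, φ, hl, hφ⟩ := exists_subseq_of_equicontinuousAt
    (fun n x => (f (k n)).sphereMap x) hU hk'
  refine ⟨k ∘ l, φ, hk.comp hl, fun K hK hKc ε hε => ?_⟩
  filter_upwards [hφ K hK hKc (ε / Real.pi) (div_pos hε Real.pi_pos)] with n hn z hz
  refine (sphericalDist_le_pi_mul _ _).trans_lt ?_
  rw [← lt_div_iff₀' Real.pi_pos]
  exact hn z hz

theorem Poly.sphereMap_coe (g : Poly) (z : ℂ) :
    g.sphereMap (z : Sphere) = (g.eval z : Sphere) := rfl

theorem Poly.sphereMap_infty (g : Poly) : g.sphereMap ∞ = ∞ := rfl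

theorem Poly.differentiable_eval (g : Poly) : Differentiable ℂ g.eval :=
  g.toPolynomial.differentiable

theorem Poly.continuous_eval (g : Poly) : Continuous g.eval := g.toPolynomial.continuous

/-- Schwarz's lemma makes a uniformly bounded family of holomorphic functions equi-Lipschitz. -/
theorem dist_le_of_norm_le_on_ball {f : ℂ → ℂ} {z₀ z : ℂ} {ρ M : ℝ}
    (hf : DifferentiableOn ℂ f (ball z₀ ρ)) (hM : ∀ z ∈ ball z₀ ρ, ‖f z‖ ≤ M)
    (hz : z ∈ ball z₀ ρ) : dist (f z) (f z₀) ≤ 2 * M / ρ * dist z z₀ := by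
  refine Complex.dist_le_div_mul_dist_of_mapsTo_ball hf (fun w hw => ?_) hz
  have hρ : 0 < ρ := dist_nonneg.trans_lt hz
  rw [mem_closedBall, dist_eq_norm]
  have := norm_sub_le (f w) (f z₀)
  linarith [hM w hw, hM z₀ (mem_ball_self hρ)]

theorem equicontinuousAt_coe_of_lipschitz {f : ℕ → Poly} {z₀ : ℂ} {ρ L : ℝ} (hρ : 0 < ρ)
    (h : ∀ n, ∀ z ∈ ball z₀ ρ, halfChord ((f n).eval z : Sphere) ((f n).eval z₀ : Sphere) ≤
      L * dist z z₀) :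
    EquicontinuousAt (fun n x => chordEmb ((f n).sphereMap x)) (z₀ : Sphere) := by
  rw [Metric.equicontinuousAt_iff_right]
  intro ε hε
  rw [OnePoint.nhds_coe_eq, eventually_map]
  have h1 : Tendsto (fun z => L * dist z z₀) (𝓝 z₀) (𝓝 0) := by
    have : Continuous fun z => L * dist z z₀ := by fun_prop
    simpa using this.tendsto z₀
  filter_upwards [ball_mem_nhds z₀ hρ, h1.eventually_lt_const hε] with z hz hz' n
  rw [dist_comm, ← halfChord_eq_dist, Poly.sphereMap_coe, Poly.sphereMap_coe]
  exact (h n z hz).trans_lt hz'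

theorem equicontinuousAt_coe_of_norm_le {f : ℕ → Poly} {z₀ : ℂ} {ρ M : ℝ} (hρ : 0 < ρ)
    (h : ∀ n, ∀ z ∈ ball z₀ ρ, ‖(f n).eval z‖ ≤ M) :
    EquicontinuousAt (fun n x => chordEmb ((f n).sphereMap x)) (z₀ : Sphere) :=
  equicontinuousAt_coe_of_lipschitz hρ fun n z hz => (halfChord_coe_coe_le _ _).trans <| by
    rw [← dist_eq_norm]
    exact dist_le_of_norm_le_on_ball (f n).differentiable_eval.differentiableOn (h n) hz

theorem equicontinuousAt_coe_of_le_norm {f : ℕ → Poly} {z₀ : ℂ} {ρ m : ℝ} (hρ : 0 < ρ)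
    (hm : 0 < m) (h : ∀ n, ∀ z ∈ ball z₀ ρ, m ≤ ‖(f n).eval z‖) :
    EquicontinuousAt (fun n x => chordEmb ((f n).sphereMap x)) (z₀ : Sphere) := by
  have hne : ∀ n, ∀ z ∈ ball z₀ ρ, (f n).eval z ≠ 0 := fun n z hz =>
    norm_pos_iff.1 (hm.trans_le (h n z hz))
  refine equicontinuousAt_coe_of_lipschitz (L := 2 * m⁻¹ / ρ) hρ fun n z hz =>
    (halfChord_coe_coe_le_inv (hne n z hz) (hne n z₀ (mem_ball_self hρ))).trans ?_
  rw [← dist_eq_norm]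
  refine dist_le_of_norm_le_on_ball (f := fun z => ((f n).eval z)⁻¹)
    ((f n).differentiable_eval.differentiableOn.inv (hne n)) (fun w hw => ?_) hz
  rw [norm_inv]
  exact inv_anti₀ hm (h n w hw)

theorem equicontinuousAt_infty {f : ℕ → Poly} {R C : ℝ}
    (h : ∀ n, ∀ z, R ≤ ‖z‖ → ‖z‖ - C ≤ ‖(f n).eval z‖) :
    EquicontinuousAt (fun n x => chordEmb ((f n).sphereMap x)) (∞ : Sphere) := by
  rw [Metric.equicontinuousAt_iff_right]
  intro ε hε
  rw [OnePoint.nhds_infty_eq, eventually_sup, eventually_map, coclosedCompact_eq_cocompact]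
  refine ⟨?_, by simpa [Poly.sphereMap_infty] using hε⟩
  filter_upwards [(tendsto_norm_cocompact_atTop (E := ℂ)).eventually_gt_atTop (1 / ε + C),
    (tendsto_norm_cocompact_atTop (E := ℂ)).eventually_ge_atTop R] with z hz hzR n
  rw [dist_comm, ← halfChord_eq_dist, Poly.sphereMap_coe, Poly.sphereMap_infty]
  have h0 : 0 < 1 / ε := by positivity
  have h1 : 1 / ε < ‖(f n).eval z‖ := by linarith [h n z hzR]
  refine (halfChord_coe_infty_le (h0.trans h1) le_rfl).trans_lt ?_
  rwa [one_div_lt (h0.trans h1) hε]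

/-- If every element of `G` either maps the open plane set `S` into a given bounded set, or keeps
it away from the origin, then `S` lies in the Fatou set. -/
theorem coe_mem_fatouSet_of_dichotomy (G : Subsemigroup Poly) {S : Set ℂ} (hS : IsOpen S)
    {M m : ℝ} (hm : 0 < m)
    (h : ∀ g ∈ G, (∀ z ∈ S, ‖g.eval z‖ ≤ M) ∨ (∀ z ∈ S, m ≤ ‖g.eval z‖)) {z : ℂ} (hz : z ∈ S) :
    (z : Sphere) ∈ fatouSet G := by
  refine ⟨(↑) '' S, OnePoint.isOpenEmbedding_coe.isOpenMap S hS, ⟨z, hz, rfl⟩, ?_⟩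
  refine isNormalOn_of_subseq G (OnePoint.isOpenEmbedding_coe.isOpenMap S hS) fun f hf => ?_
  by_cases hfr : ∃ᶠ n in atTop, ∀ z ∈ S, ‖(f n).eval z‖ ≤ M
  · obtain ⟨k, hk, hk'⟩ := extraction_of_frequently_atTop hfr
    refine ⟨k, hk, ?_⟩
    rintro _ ⟨w, hw, rfl⟩
    obtain ⟨ρ, hρ, hb⟩ := Metric.isOpen_iff.1 hS w hw
    exact equicontinuousAt_coe_of_norm_le hρ fun n z hz => hk' n z (hb hz)
  · rw [not_frequently] at hfr
    obtain ⟨k, hk, hk'⟩ := extraction_of_eventually_atTop hfr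
    refine ⟨k, hk, ?_⟩
    rintro _ ⟨w, hw, rfl⟩
    obtain ⟨ρ, hρ, hb⟩ := Metric.isOpen_iff.1 hS w hw
    exact equicontinuousAt_coe_of_le_norm hρ hm fun n z hz =>
      (h _ (hf _)).resolve_left (hk' n) z (hb hz)

theorem coe_mem_fatouSet_of_mapsTo (G : Subsemigroup Poly) {K : Set ℂ}
    (hK : Bornology.IsBounded K) (h : ∀ g ∈ G, Set.MapsTo g.eval K K) {z : ℂ}
    (hz : z ∈ interior K) : (z : Sphere) ∈ fatouSet G := by
  obtain ⟨M, hM⟩ := hK.exists_norm_le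
  exact coe_mem_fatouSet_of_dichotomy G isOpen_interior one_pos
    (fun g hg => Or.inl fun z hz => hM _ (h g hg (interior_subset hz))) hz

/-- `∞` is in the Fatou set when the elements of `G` do not move points of a neighbourhood of `∞`
towards a fixed centre. -/
theorem infty_mem_fatouSet (G : Subsemigroup Poly) {b : ℂ} {R : ℝ} (hR : ‖b‖ < R)
    (h : ∀ g ∈ G, ∀ z, R < ‖z - b‖ → ‖z - b‖ ≤ ‖g.eval z - b‖) : ∞ ∈ fatouSet G := by
  have hopen : IsOpen ((↑) '' closedBall b R : Set Sphere)ᶜ :=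
    OnePoint.isOpen_compl_image_coe.2 ⟨isClosed_closedBall, isCompact_closedBall _ _⟩
  refine ⟨_, hopen, by simp, isNormalOn_of_subseq G hopen fun f hf => ⟨id, strictMono_id, ?_⟩⟩
  intro x hx
  induction x using OnePoint.rec
  · refine equicontinuousAt_infty (R := R + ‖b‖ + 1) (C := 2 * ‖b‖) fun n z hz => ?_
    have h1 := norm_sub_norm_le z b
    have h2 := norm_sub_le ((f n).eval z) b
    have := h _ (hf n) z (by linarith)
    simp only [id]
    linarith
  · rename_i w
    have hw : R < ‖w - b‖ := by
      by_contra hc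
      exact hx ⟨w, by simpa [dist_eq_norm] using hc, rfl⟩
    refine equicontinuousAt_coe_of_le_norm (ρ := ‖w - b‖ - R) (m := R - ‖b‖) (by linarith)
      (by linarith) fun n z hz => ?_
    have h1 : R < ‖z - b‖ := by
      rw [mem_ball, dist_comm, dist_eq_norm] at hz
      have := norm_sub_le_norm_sub_add_norm_sub w z b
      linarith
    have h2 := norm_sub_le ((f n).eval z) b
    have := h _ (hf n) z h1
    simp only [id]
    linarith

theorem coe_mem_fatouSet_of_expanding (G : Subsemigroup Poly) {b : ℂ} {R : ℝ} (hR : ‖b‖ < R)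
    (h : ∀ g ∈ G, ∀ z, R < ‖z - b‖ → ‖z - b‖ ≤ ‖g.eval z - b‖) {z : ℂ} (hz : R < ‖z - b‖) :
    (z : Sphere) ∈ fatouSet G := by
  refine coe_mem_fatouSet_of_dichotomy G (S := {z | R < ‖z - b‖})
    (isOpen_lt continuous_const (by fun_prop)) (M := 0) (m := R - ‖b‖) (by linarith) ?_ hz
  intro g hg
  refine Or.inr fun z hz => ?_
  have h2 := norm_sub_le (g.eval z) b
  have := h g hg z hz
  have : R < ‖z - b‖ := hz
  linarith

theorem fatouSet_anti {G H : Subsemigroup Poly} (h : G ≤ H) : fatouSet H ⊆ fatouSet G := by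
  rintro z ⟨U, hU, hz, hn⟩
  exact ⟨U, hU, hz, fun f hf => hn f fun n => h (hf n)⟩

theorem juliaSet_mono {G H : Subsemigroup Poly} (h : G ≤ H) : juliaSet G ⊆ juliaSet H :=
  Set.compl_subset_compl.2 (fatouSet_anti h)

/-- Near a point of the Fatou set whose orbit is bounded, the orbits are bounded. -/
theorem mem_interior_of_mem_fatouSet (G : Subsemigroup Poly) {z : ℂ}
    (hz : z ∈ smallestFilledJulia G) (hF : (z : Sphere) ∈ fatouSet G) :
    z ∈ interior (smallestFilledJulia G) := by
  by_contra hc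
  obtain ⟨U, hU, hzU, hn⟩ := hF
  obtain ⟨M, hM⟩ := Bornology.IsBounded.exists_norm_le (s := {w : ℂ | ∃ g ∈ G, w = g.eval z}) hz
  have hM0 : ∀ g ∈ G, ‖g.eval z‖ ≤ M := fun g hg => hM _ ⟨g, hg, rfl⟩
  -- Points tending to `z` whose orbits leave larger and larger discs.
  have hex : ∀ n : ℕ, ∃ w : ℂ, dist w z < 1 / (n + 1) ∧ ∃ g ∈ G, (n : ℝ) < ‖g.eval w‖ := by
    intro n
    by_contra hcon
    push Not at hcon
    refine hc (mem_interior_iff_mem_nhds.2 (mem_of_superset (ball_mem_nhds z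
      (by positivity : (0 : ℝ) < 1 / (n + 1))) fun w hw => ?_))
    refine (isBounded_iff_forall_norm_le (s := {z : ℂ | ∃ g ∈ G, z = g.eval w})).2 ⟨n, ?_⟩
    rintro _ ⟨g, hg, rfl⟩
    exact hcon w hw g hg
  choose w hw g hg hgw using hex
  obtain ⟨k, φ, hk, hφ⟩ := hn g hg
  have hwz : Tendsto (fun n => w (k n)) atTop (𝓝 z) := by
    rw [tendsto_iff_dist_tendsto_zero]
    exact squeeze_zero (fun _ => dist_nonneg) (fun n => (hw (k n)).le)
      (tendsto_one_div_add_atTop_nhds_zero_nat.comp hk.tendsto_atTop)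
  obtain ⟨ρ, hρ, hb⟩ := Metric.nhds_basis_closedBall.mem_iff.1
    (OnePoint.continuous_coe.continuousAt.preimage_mem_nhds (hU.mem_nhds hzU))
  have hKc : IsCompact (((↑) : ℂ → Sphere) '' closedBall z ρ) :=
    (isCompact_closedBall z ρ).image OnePoint.continuous_coe
  have hKU : ((↑) : ℂ → Sphere) '' closedBall z ρ ⊆ U := by
    rintro _ ⟨x, hx, rfl⟩
    exact hb hx
  set s := √(1 + M ^ 2) with hs
  have hs1 : 1 ≤ s := one_le_sqrt_one_add_sq M
  set ε := 1 / (20 * s) with hε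
  have hε0 : 0 < ε := by positivity
  obtain ⟨N, hN⟩ := eventually_atTop.1 (hφ _ hKU hKc ε hε0)
  have hcont : Tendsto (fun n => (g (k N)).eval (w (k n))) atTop (𝓝 ((g (k N)).eval z)) :=
    ((g (k N)).continuous_eval.tendsto z).comp hwz
  have hlarge : Tendsto (fun n => (k n : ℝ)) atTop atTop :=
    tendsto_natCast_atTop_atTop.comp hk.tendsto_atTop
  obtain ⟨n, h1, h2, h3, h4⟩ := ((eventually_ge_atTop N).and ((hlarge.eventually_ge_atTop
    (20 * s)).and ((hcont.eventually (ball_mem_nhds _ hε0)).and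
      (hwz.eventually (closedBall_mem_nhds z hρ))))).exists
  have hd : ∀ x y, halfChord x y < ε → halfChord y x < ε := fun x y h => by
    rwa [halfChord_comm]
  have hlt : ∀ x y, sphericalDist x y < ε → halfChord x y < ε := fun x y h => by
    linarith [two_mul_halfChord_le x y, halfChord_nonneg x y]
  have a1 := hlt _ _ (hN n h1 (w (k n)) ⟨_, h4, rfl⟩)
  have a2 := hd _ _ (hlt _ _ (hN N le_rfl (w (k n)) ⟨_, h4, rfl⟩))
  have a3 : halfChord ((g (k N)).eval (w (k n)) : Sphere) ((g (k N)).eval z : Sphere) < ε :=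
    (halfChord_coe_coe_le _ _).trans_lt (by simpa [dist_eq_norm] using h3)
  have a4 : halfChord ∞ ((g (k n)).eval (w (k n)) : Sphere) ≤ ε := by
    rw [halfChord_comm]
    exact halfChord_coe_infty_le (by positivity) (h2.trans (hgw (k n)).le)
  have a5 : 1 / s ≤ halfChord ∞ ((g (k N)).eval z : Sphere) := by
    rw [halfChord_infty_coe]
    refine one_div_le_one_div_of_le (by positivity) (Real.sqrt_le_sqrt ?_)
    have := hM0 _ (hg (k N))
    gcongr
  have t1 := halfChord_triangle ∞ ((g (k n)).eval (w (k n)) : Sphere) ((g (k N)).eval z : Sphere)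
  have t2 := halfChord_triangle ((g (k n)).eval (w (k n)) : Sphere) (φ (w (k n)))
    ((g (k N)).eval z : Sphere)
  have t3 := halfChord_triangle (φ (w (k n))) ((g (k N)).eval (w (k n)) : Sphere)
    ((g (k N)).eval z : Sphere)
  rw [Poly.sphereMap_coe] at a1 a2
  have : 1 / s = 20 * ε := by rw [hε]; field_simp
  linarith

/-! ### Preimages of discs under polynomials -/

/-- The critical values in the plane. -/
def Poly.planeCriticalValues (g : Poly) : Set ℂ :=
  g.eval '' {z | g.toPolynomial.derivative.eval z = 0}

theorem Poly.toPolynomial_ne_zero (g : Poly) : g.toPolynomial ≠ 0 :=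
  Polynomial.ne_zero_of_natDegree_gt g.natDegree_pos

theorem Poly.finite_planeCriticalValues (g : Poly) : g.planeCriticalValues.Finite := by
  have h : g.toPolynomial.derivative ≠ 0 := by
    intro h
    exact g.natDegree_pos.ne' (Polynomial.derivative_eq_zero.1 h)
  refine Set.Finite.image _ ((g.toPolynomial.derivative.roots.toFinset.finite_toSet).subset ?_)
  intro z hz
  simpa [h] using hz

theorem Poly.isCoveringMapOn_eval (g : Poly) : IsCoveringMapOn g.eval g.planeCriticalValuesᶜ :=
  g.toPolynomial.isCoveringMapOn_eval

/-- Over a disc without critical values, a polynomial is injective on connected sets: by simple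
connectedness of the disc there is a global inverse branch. -/
theorem Poly.injOn_of_disjoint_planeCriticalValues (g : Poly) {y : ℂ} {δ : ℝ}
    (hcv : Disjoint (ball y δ) g.planeCriticalValues) {C : Set ℂ} (hC : IsPreconnected C)
    (hCg : Set.MapsTo g.eval C (ball y δ)) : Set.InjOn g.eval C := by
  rcases C.eq_empty_or_nonempty with rfl | ⟨x, hx⟩
  · exact Set.injOn_empty _
  have hsub : ball y δ ⊆ g.planeCriticalValuesᶜ := Set.subset_compl_iff_disjoint_right.2 hcv
  have : ContractibleSpace (ball y δ) :=
    (convex_ball y δ).contractibleSpace ⟨_, hCg hx⟩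
  have : LocallyPathConnectedSpace (ball y δ) := isOpen_ball.locallyPathConnectedSpace
  obtain ⟨F, ⟨hF1, hF2⟩, -⟩ := g.isCoveringMapOn_eval.existsUnique_continuousMap_lifts
    (A := ball y δ) ⟨Subtype.val, continuous_subtype_val⟩ (a₀ := ⟨g.eval x, hCg hx⟩) (e₀ := x) rfl
    (fun a => hsub a.2)
  have hF (a : ball y δ) : g.eval (F a) = a := congrFun hF2 a
  have hcov := g.isCoveringMapOn_eval.isCoveringMap_restrictPreimage
  -- `F ∘ g` and the inclusion are two lifts of `g` on `C`.
  have : PreconnectedSpace C := isPreconnected_iff_preconnectedSpace.1 hC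
  have key := hcov.eq_of_comp_eq (A := C)
    (g₁ := fun z => ⟨F ⟨g.eval z, hCg z.2⟩, by
      rw [Set.mem_preimage, hF]; exact hsub (hCg z.2)⟩)
    (g₂ := fun z => ⟨z, hsub (hCg z.2)⟩)
    (by
      have := g.continuous_eval
      fun_prop) (by fun_prop)
    (by ext z; exact hF _) ⟨x, hx⟩ (Subtype.ext hF1)
  have key' (z : ℂ) (hz : z ∈ C) : F ⟨g.eval z, hCg hz⟩ = z :=
    congrArg Subtype.val (congrFun key ⟨z, hz⟩)
  intro z hz w hw hzw
  rw [← key' z hz, ← key' w hw]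
  congr 2

/-- `g` is at most `N`-to-one on every connected subset of the preimage of `D`. -/
def DegreeAtMost (g : Poly) (D : Set ℂ) (N : ℕ) : Prop :=
  ∀ C : Set ℂ, IsPreconnected C → Set.MapsTo g.eval C D → ∀ w, (C ∩ g.eval ⁻¹' {w}).encard ≤ N

theorem DegreeAtMost.mono {g : Poly} {D D' : Set ℂ} {N N' : ℕ} (h : DegreeAtMost g D N)
    (hD : D' ⊆ D) (hN : N ≤ N') : DegreeAtMost g D' N' :=
  fun C hC hg w => (h C hC (hg.mono_right hD) w).trans (by exact_mod_cast hN)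

theorem degreeAtMost_one (g : Poly) {y : ℂ} {δ : ℝ}
    (hcv : Disjoint (ball y δ) g.planeCriticalValues) : DegreeAtMost g (ball y δ) 1 := by
  intro C hC hg w
  have hinj := g.injOn_of_disjoint_planeCriticalValues hcv hC hg
  rw [Nat.cast_one, Set.encard_le_one_iff]
  rintro a c ⟨ha, ha'⟩ ⟨hc, hc'⟩
  exact hinj ha hc (ha'.trans hc'.symm)

theorem notMem_of_mem_frontier_connectedComponentIn {O : Set ℂ} (hO : IsOpen O) {x z : ℂ}
    (hz : z ∈ frontier (connectedComponentIn O x)) : z ∉ O := by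
  intro hzO
  have hopen : IsOpen (connectedComponentIn O x) := hO.connectedComponentIn
  rw [hopen.frontier_eq] at hz
  obtain ⟨u, hu, hu'⟩ := mem_closure_iff.1 hz.1 _ (hO.connectedComponentIn (x := z))
    (mem_connectedComponentIn hzO)
  refine hz.2 ?_
  rw [connectedComponentIn_eq hu', ← connectedComponentIn_eq hu]
  exact mem_connectedComponentIn hzO

theorem Poly.isOpenMap_eval (g : Poly) : IsOpenMap g.eval := by
  intro s hs
  have ha : AnalyticOnNhd ℂ g.eval Set.univ :=
    g.differentiable_eval.differentiableOn.analyticOnNhd isOpen_univ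
  rcases ha.is_constant_or_isOpen isPreconnected_univ with ⟨w, hw⟩ | h
  · exfalso
    have h1 : g.toPolynomial = Polynomial.C w := Polynomial.funext fun z => by
      rw [Polynomial.eval_C]; exact hw z trivial
    have := g.natDegree_pos
    rw [h1, Polynomial.natDegree_C] at this
    exact lt_irrefl _ this
  · exact h s (Set.subset_univ _) hs

/-- Polynomials map the components of the preimage of a disc onto the disc. -/
theorem Poly.ball_subset_image_connectedComponentIn (g : Poly) {y x : ℂ} {δ : ℝ}
    (hx : g.eval x ∈ ball y δ) :
    ball y δ ⊆ g.eval '' connectedComponentIn (g.eval ⁻¹' ball y δ) x := by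
  have hO : IsOpen (g.eval ⁻¹' ball y δ) := isOpen_ball.preimage g.continuous_eval
  refine (convex_ball y δ).isPreconnected.subset_of_closure_inter_subset
    (g.isOpenMap_eval _ hO.connectedComponentIn)
    ⟨_, hx, x, mem_connectedComponentIn hx, rfl⟩ ?_
  rintro w ⟨hw, hwy⟩
  have hcl : IsClosed (g.eval '' closure (connectedComponentIn (g.eval ⁻¹' ball y δ) x)) :=
    g.toPolynomial.isClosedMap_eval _ isClosed_closure
  obtain ⟨z, hz, rfl⟩ := closure_minimal (Set.image_mono subset_closure) hcl hw
  refine ⟨z, ?_, rfl⟩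
  by_contra hc
  refine notMem_of_mem_frontier_connectedComponentIn hO (x := x) ?_ hwy
  rw [hO.connectedComponentIn.frontier_eq]
  exact ⟨hz, hc⟩

/-- A connected subset of a union of `n` small discs is small. -/
theorem dist_le_of_isPreconnected_of_subset_biUnion {C : Set ℂ} (hC : IsPreconnected C)
    (F : Finset ℂ) {ε : ℝ} (hε : 0 < ε) (hF : ∀ z ∈ C, ∃ u ∈ F, dist z u < ε) {x z : ℂ}
    (hx : x ∈ C) (hz : z ∈ C) : dist z x ≤ F.card * (2 * ε) := by
  have hI : Set.Icc 0 (dist z x) ⊆ ⋃ u ∈ F, Set.Icc (dist u x - ε) (dist u x + ε) := by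
    intro t ht
    have h1 : IsPreconnected ((fun z => dist z x) '' C) :=
      hC.image _ (by fun_prop : Continuous fun z => dist z x).continuousOn
    have h2 := h1.Icc_subset ⟨x, hx, dist_self x⟩ ⟨z, hz, rfl⟩ ht
    obtain ⟨w, hw, rfl⟩ := h2
    obtain ⟨u, hu, hwu⟩ := hF w hw
    refine Set.mem_biUnion hu ?_
    have h3 := dist_triangle w u x
    have h4 := dist_triangle u w x
    rw [dist_comm u w] at h4
    simp only [Set.mem_Icc]
    constructor <;> linarith
  have h1 := (MeasureTheory.measure_mono hI).trans
    (MeasureTheory.measure_biUnion_finset_le (μ := MeasureTheory.volume) F _)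
  simp only [Real.volume_Icc, sub_zero] at h1
  have h2 (u : ℂ) : dist u x + ε - (dist u x - ε) = 2 * ε := by ring
  simp only [h2, Finset.sum_const, nsmul_eq_mul] at h1
  rw [← ENNReal.ofReal_natCast, ← ENNReal.ofReal_mul (by positivity)] at h1
  exact (ENNReal.ofReal_le_ofReal_iff (by positivity)).1 h1

theorem Poly.exists_prod_eq (p : Poly) {y : ℂ} (hy : y ∉ p.planeCriticalValues) :
    ∃ (F : Finset ℂ) (l : ℂ), l ≠ 0 ∧ (∀ u ∈ F, p.eval u = y) ∧
      ∀ z, p.eval z - y = l * ∏ u ∈ F, (z - u) := by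
  set P := p.toPolynomial - Polynomial.C y with hP
  have hdeg : P.natDegree = p.toPolynomial.natDegree := Polynomial.natDegree_sub_C
  have hP0 : P ≠ 0 := Polynomial.ne_zero_of_natDegree_gt (hdeg ▸ p.natDegree_pos)
  have hroot : ∀ u, P.IsRoot u ↔ p.eval u = y := fun u => by
    rw [Polynomial.IsRoot, hP, Polynomial.eval_sub, Polynomial.eval_C, sub_eq_zero]; rfl
  have hnd : P.roots.Nodup := by
    rw [Multiset.nodup_iff_count_le_one]
    intro u
    rw [Polynomial.count_roots]
    by_contra hc
    obtain ⟨h1, h2⟩ := (Polynomial.one_lt_rootMultiplicity_iff_isRoot hP0).1 (not_le.1 hc)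
    refine hy ⟨u, ?_, (hroot u).1 h1⟩
    simpa [hP] using h2
  refine ⟨P.roots.toFinset, P.leadingCoeff, Polynomial.leadingCoeff_ne_zero.2 hP0, ?_, ?_⟩
  · intro u hu
    rw [Multiset.mem_toFinset] at hu
    exact (hroot u).1 (Polynomial.isRoot_of_mem_roots hu)
  · intro z
    have h1 := (IsAlgClosed.splits P).eval_eq_prod_roots z
    have h2 : P.eval z = p.eval z - y := by rw [hP, Polynomial.eval_sub, Polynomial.eval_C]; rfl
    rw [← h2, h1, Finset.prod_multiset_map_count]
    congr 1
    refine Finset.prod_congr rfl fun u hu => ?_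
    rw [Multiset.count_eq_one_of_mem hnd (Multiset.mem_toFinset.1 hu), pow_one]

/-- Bounded degree over a disc forces the components of the preimages of a much smaller
concentric disc to be small, uniformly in the polynomial and the disc. With `V` a component of the
preimage of the large disc and `u₁, …, uₘ` the preimages in `V` of a generic point `y'` near the
centre, the minimum principle on `V` bounds `(p - y') / ∏ (z - uᵢ)` from below, so `∏ (z - uᵢ)` is
small wherever `p` is near `y'`. -/
theorem exists_radius_preimage_small (b : ℂ) (R : ℝ) (N : ℕ) {δ ε : ℝ} (hδ : 0 < δ) (hε : 0 < ε) :
    ∃ δ' > 0, δ' ≤ δ ∧ ∀ (p : Poly) (y : ℂ), (∀ z, p.eval z ∈ ball y δ → dist z b ≤ R) →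
      DegreeAtMost p (ball y δ) N → ∀ C : Set ℂ, IsPreconnected C →
      Set.MapsTo p.eval C (ball y δ') → ∀ x ∈ C, C ⊆ ball x ε := by
  set B : ℝ := 2 * |R| + 1 with hB
  have hB1 : 1 ≤ B := by have := abs_nonneg R; linarith
  set A : ℝ := B ^ N with hA
  have hA0 : 0 < A := by positivity
  set ε₁ : ℝ := min 1 (ε / (4 * (N + 1))) with hε₁
  have hε₁0 : 0 < ε₁ := lt_min one_pos (by positivity)
  refine ⟨min (δ / 4) (δ * ε₁ ^ N / (8 * A)), by positivity,
    (min_le_left _ _).trans (by linarith), ?_⟩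
  set δ' := min (δ / 4) (δ * ε₁ ^ N / (8 * A)) with hδ'
  have hδ'0 : 0 < δ' := by positivity
  have hδ'1 : δ' ≤ δ / 4 := min_le_left _ _
  have hδ'2 : δ' * (8 * A) ≤ δ * ε₁ ^ N := by
    rw [← le_div_iff₀ (by positivity)]; exact min_le_right _ _
  intro p y hR hN C hC hCp x hx
  -- a generic point near the centre
  obtain ⟨y', hy', hcv⟩ : ∃ y' ∈ ball y δ', y' ∉ p.planeCriticalValues := by
    have h1 : (ball y δ').Infinite := infinite_of_mem_nhds y (ball_mem_nhds y hδ'0)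
    obtain ⟨y', h2, h3⟩ := (h1.sdiff p.finite_planeCriticalValues).nonempty
    exact ⟨y', h2, h3⟩
  obtain ⟨F, l, hl, hF, hprod⟩ := p.exists_prod_eq hcv
  have hO : IsOpen (p.eval ⁻¹' ball y δ) := isOpen_ball.preimage p.continuous_eval
  have hsub : ball y δ' ⊆ ball y δ := ball_subset_ball (by linarith)
  set V := connectedComponentIn (p.eval ⁻¹' ball y δ) x with hV
  have hCV : C ⊆ V := hC.subset_connectedComponentIn hx (hCp.mono_right hsub)
  have hVsub : V ⊆ p.eval ⁻¹' ball y δ := connectedComponentIn_subset _ _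
  have hVR : closure V ⊆ closedBall b R :=
    closure_minimal (fun z hz => hR z (hVsub hz)) isClosed_closedBall
  have hfr : ∀ z ∈ frontier V, δ / 2 ≤ ‖p.eval z - y'‖ := by
    intro z hz
    have h1 := notMem_of_mem_frontier_connectedComponentIn hO hz
    rw [Set.mem_preimage, mem_ball, not_lt, dist_eq_norm] at h1
    rw [mem_ball, dist_eq_norm] at hy'
    have h2 := norm_sub_le_norm_sub_add_norm_sub (p.eval z) y' y
    linarith
  classical
  set F₁ := F.filter (· ∈ V) with hF₁
  set F₂ := F.filter (· ∉ V) with hF₂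
  have hsplit : ∀ z, p.eval z - y' = (∏ u ∈ F₁, (z - u)) * (l * ∏ u ∈ F₂, (z - u)) := by
    intro z
    rw [hprod, ← Finset.prod_filter_mul_prod_filter_not F (· ∈ V)]
    ring
  have hcard : F₁.card ≤ N := by
    have h1 := hN V isPreconnected_connectedComponentIn hVsub y'
    have h2 : (F₁ : Set ℂ) ⊆ V ∩ p.eval ⁻¹' {y'} := by
      intro u hu
      rw [hF₁, Finset.mem_coe, Finset.mem_filter] at hu
      exact ⟨hu.2, hF u hu.1⟩
    have h3 := (Set.encard_le_encard h2).trans h1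
    rw [Set.encard_coe_eq_coe_finsetCard] at h3
    exact_mod_cast h3
  have hq₁ : ∀ z ∈ closure V, ‖∏ u ∈ F₁, (z - u)‖ ≤ A := by
    intro z hz
    rw [norm_prod]
    have h1 : ∀ u ∈ F₁, ‖z - u‖ ≤ B := by
      intro u hu
      have h2 := hVR (subset_closure (Finset.mem_filter.1 hu).2)
      have h3 := hVR hz
      rw [mem_closedBall] at h2 h3
      have h4 := dist_triangle_right z u b
      rw [← dist_eq_norm]
      have := le_abs_self R
      linarith
    calc ∏ u ∈ F₁, ‖z - u‖ ≤ ∏ u ∈ F₁, B :=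
          Finset.prod_le_prod (fun _ _ => norm_nonneg _) h1
      _ = B ^ F₁.card := Finset.prod_const _
      _ ≤ A := pow_le_pow_right₀ hB1 hcard
  have hq₂ne : ∀ z ∈ closure V, l * ∏ u ∈ F₂, (z - u) ≠ 0 := by
    intro z hz h0
    by_cases hzV : z ∈ V
    · rcases mul_eq_zero.1 h0 with h | h
      · exact hl h
      · obtain ⟨u, hu, hu'⟩ := Finset.prod_eq_zero_iff.1 h
        rw [sub_eq_zero.1 hu'] at hzV
        exact (Finset.mem_filter.1 hu).2 hzV
    · have h1 := hfr z (by rw [hO.connectedComponentIn.frontier_eq]; exact ⟨hz, hzV⟩)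
      rw [hsplit, h0, mul_zero, norm_zero] at h1
      linarith
  have hmin : ∀ z ∈ V, ‖(l * ∏ u ∈ F₂, (z - u))⁻¹‖ ≤ 2 * A / δ := by
    intro z hz
    have hdiff : Differentiable ℂ fun z => l * ∏ u ∈ F₂, (z - u) := by fun_prop
    refine Complex.norm_le_of_forall_mem_frontier_norm_le
      (isBounded_closedBall.subset (subset_closure.trans hVR)) (hdiff.diffContOnCl.inv hq₂ne)
      (fun w hw => ?_) (subset_closure hz)
    have h1 := hfr w hw
    have h2 := hq₁ w (frontier_subset_closure hw)
    have h3 := norm_pos_iff.2 (hq₂ne w (frontier_subset_closure hw))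
    rw [hsplit, norm_mul] at h1
    rw [Pi.inv_apply, norm_inv, inv_le_comm₀ h3 (by positivity), inv_div,
      div_le_iff₀ (by positivity)]
    nlinarith
  have hnear : ∀ z ∈ C, ∃ u ∈ F₁, dist z u < ε₁ := by
    intro z hz
    by_contra hcon
    push Not at hcon
    have h1 : ε₁ ^ N ≤ ‖∏ u ∈ F₁, (z - u)‖ := by
      rw [norm_prod]
      calc ε₁ ^ N ≤ ε₁ ^ F₁.card := pow_le_pow_of_le_one hε₁0.le (min_le_left _ _) hcard
        _ = ∏ u ∈ F₁, ε₁ := (Finset.prod_const _).symm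
        _ ≤ ∏ u ∈ F₁, ‖z - u‖ := Finset.prod_le_prod (fun _ _ => hε₁0.le) fun u hu => by
          rw [← dist_eq_norm]; exact hcon u hu
    have h2 : ‖p.eval z - y'‖ < 2 * δ' := by
      have h3 := hCp hz
      rw [mem_ball] at h3 hy'
      rw [← dist_eq_norm]
      linarith [dist_triangle_right (p.eval z) y' y]
    have h3 := norm_pos_iff.2 (hq₂ne z (subset_closure (hCV hz)))
    have h4 := hmin z (hCV hz)
    rw [norm_inv, inv_le_comm₀ h3 (by positivity), inv_div, div_le_iff₀ (by positivity)] at h4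
    rw [hsplit, norm_mul] at h2
    have h5 : 0 < ε₁ ^ N := by positivity
    nlinarith [mul_le_mul h1 h4 hδ.le (norm_nonneg _)]
  intro z hz
  have h1 := dist_le_of_isPreconnected_of_subset_biUnion hC F₁ hε₁0 hnear hx hz
  have h2 : (F₁.card : ℝ) ≤ N := by exact_mod_cast hcard
  have h3 : ε₁ * (4 * (N + 1)) ≤ ε := by
    rw [← le_div_iff₀ (by positivity)]; exact min_le_right _ _
  rw [mem_ball]
  nlinarith

/-! ### The topology of the space of polynomials -/

theorem norm_eval_le_of_coeff_le {p : ℂ[X]} {n : ℕ} {C : ℝ} (hp : p.natDegree ≤ n)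
    (hC : ∀ k, ‖p.coeff k‖ ≤ C) {z : ℂ} {T : ℝ} (hT : 1 ≤ T) (hz : ‖z‖ ≤ T) :
    ‖p.eval z‖ ≤ (n + 1) * C * T ^ n := by
  rw [Polynomial.eval_eq_sum_range' (Nat.lt_succ_of_le hp)]
  refine (norm_sum_le _ _).trans ?_
  have hC0 : 0 ≤ C := (norm_nonneg _).trans (hC 0)
  calc ∑ k ∈ Finset.range (n + 1), ‖p.coeff k * z ^ k‖
      ≤ ∑ k ∈ Finset.range (n + 1), C * T ^ n := by
        refine Finset.sum_le_sum fun k hk => ?_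
        rw [norm_mul, norm_pow]
        refine mul_le_mul (hC k) ?_ (by positivity) hC0
        exact (pow_le_pow_left₀ (norm_nonneg z) hz k).trans
          (pow_le_pow_right₀ hT (Nat.lt_succ_iff.1 (Finset.mem_range.1 hk)))
    _ = (n + 1) * C * T ^ n := by
      rw [Finset.sum_const, Finset.card_range]; push_cast [nsmul_eq_mul]; ring

/-- Growth of a polynomial of degree `n` near infinity, in terms of a lower bound of the leading
coefficient and an upper bound of the other ones. -/
theorem le_norm_eval_of_coeff_le {p : ℂ[X]} {n : ℕ} {m C : ℝ} (hn : 0 < n) (hp : p.natDegree ≤ n)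
    (hm : m ≤ ‖p.coeff n‖) (hC : ∀ k < n, ‖p.coeff k‖ ≤ C) {z : ℂ} (hz : 1 ≤ ‖z‖)
    (hz' : 2 * n * C ≤ m * ‖z‖) : m / 2 * ‖z‖ ^ n ≤ ‖p.eval z‖ := by
  obtain ⟨n, rfl⟩ := Nat.exists_eq_succ_of_ne_zero hn.ne'
  rw [Polynomial.eval_eq_sum_range' (Nat.lt_succ_of_le hp), Finset.sum_range_succ]
  have hC0 : 0 ≤ C := (norm_nonneg _).trans (hC 0 hn)
  have h1 : ‖∑ k ∈ Finset.range (n + 1), p.coeff k * z ^ k‖ ≤ (n + 1) * C * ‖z‖ ^ n := by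
    refine (norm_sum_le _ _).trans ?_
    calc ∑ k ∈ Finset.range (n + 1), ‖p.coeff k * z ^ k‖
        ≤ ∑ k ∈ Finset.range (n + 1), C * ‖z‖ ^ n := by
          refine Finset.sum_le_sum fun k hk => ?_
          rw [norm_mul, norm_pow]
          refine mul_le_mul (hC k (Finset.mem_range.1 hk)) ?_ (by positivity) hC0
          exact pow_le_pow_right₀ hz (Nat.lt_succ_iff.1 (Finset.mem_range.1 hk))
      _ = (n + 1) * C * ‖z‖ ^ n := by
        rw [Finset.sum_const, Finset.card_range]; push_cast [nsmul_eq_mul]; ring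
  have h2 : m * ‖z‖ ^ (n + 1) ≤ ‖p.coeff (n + 1) * z ^ (n + 1)‖ := by
    rw [norm_mul, norm_pow]
    gcongr
  have h3 := norm_sub_le (∑ k ∈ Finset.range (n + 1), p.coeff k * z ^ k +
    p.coeff (n + 1) * z ^ (n + 1)) (∑ k ∈ Finset.range (n + 1), p.coeff k * z ^ k)
  rw [add_sub_cancel_left] at h3
  push_cast at hz'
  have h4 := mul_le_mul_of_nonneg_right hz' (by positivity : 0 ≤ ‖z‖ ^ n)
  rw [pow_succ] at h2
  change m / 2 * ‖z‖ ^ (n + 1) ≤ _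
  rw [pow_succ ‖z‖]
  linarith

theorem norm_coeff_le_of_norm_eval_le {p : ℂ[X]} {C : ℝ} (hC : ∀ z, ‖z‖ = 1 → ‖p.eval z‖ ≤ C)
    (k : ℕ) : ‖p.coeff k‖ ≤ C := by
  have hC0 : 0 ≤ C := (norm_nonneg _).trans (hC 1 (by simp))
  refine abs_le_of_sq_le_sq' ?_ hC0 |>.2
  have h1 : ‖p.coeff k‖ ^ 2 ≤ ∑ i ∈ p.support, ‖p.coeff i‖ ^ 2 := by
    by_cases hk : k ∈ p.support
    · exact Finset.single_le_sum (f := fun i => ‖p.coeff i‖ ^ 2) (fun _ _ => by positivity) hk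
    · rw [Polynomial.notMem_support_iff.1 hk, norm_zero, zero_pow two_ne_zero]
      positivity
  rw [p.sum_sq_norm_coeff_eq_circleAverage] at h1
  refine h1.trans (Real.circleAverage_mono_on_of_le_circle ?_ fun z hz => ?_)
  · exact ContinuousOn.circleIntegrable' (by fun_prop)
  · have := hC z (by simpa using hz)
    gcongr

theorem Poly.leadingCoeff_norm_pos (g : Poly) : 0 < ‖g.toPolynomial.coeff g.degree‖ :=
  norm_pos_iff.2 (Polynomial.leadingCoeff_ne_zero.2 g.toPolynomial_ne_zero)

theorem Poly.exists_norm_coeff_le (g : Poly) : ∃ C : ℝ, 0 < C ∧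
    ∀ k, ‖g.toPolynomial.coeff k‖ ≤ C := by
  refine ⟨(∑ k ∈ g.toPolynomial.support, ‖g.toPolynomial.coeff k‖) + 1, by positivity, fun k => ?_⟩
  by_cases hk : k ∈ g.toPolynomial.support
  · have := Finset.single_le_sum (f := fun i => ‖g.toPolynomial.coeff i‖)
      (fun _ _ => norm_nonneg _) hk
    linarith
  · rw [Polynomial.notMem_support_iff.1 hk, norm_zero]
    positivity

theorem multiset_prod_sub_bounds {r : ℝ} (s : Multiset ℂ) (hs : ∀ u ∈ s, ‖u‖ ≤ r) {z : ℂ}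
    (hz : r ≤ ‖z‖) : ‖(s.map fun u => z - u).prod‖ ≤ (‖z‖ + r) ^ s.card ∧
      (‖z‖ - r) ^ s.card ≤ ‖(s.map fun u => z - u).prod‖ := by
  induction s using Multiset.induction_on with
  | empty => simp
  | cons u s ih =>
    obtain ⟨h1, h2⟩ := ih fun v hv => hs v (Multiset.mem_cons_of_mem hv)
    have hu := hs u (Multiset.mem_cons_self u s)
    rw [Multiset.map_cons, Multiset.prod_cons, Multiset.card_cons, norm_mul, pow_succ', pow_succ']
    constructor
    · exact mul_le_mul ((norm_sub_le _ _).trans (by linarith)) h1 (norm_nonneg _)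
        (by linarith [norm_nonneg z, norm_nonneg u])
    · exact mul_le_mul ((by linarith : ‖z‖ - r ≤ ‖z‖ - ‖u‖).trans (norm_sub_norm_le _ _)) h2
        (pow_nonneg (by linarith) _) (norm_nonneg _)

theorem Poly.norm_eval_mul_pow_le (h : Poly) {R T : ℝ} (hR : 0 ≤ R) (hRT : R ≤ T)
    (hroots : ∀ u ∈ h.toPolynomial.roots, ‖u‖ ≤ R) :
    ‖h.eval (R : ℂ)‖ * (T - R) ^ h.degree ≤ ‖h.eval (T : ℂ)‖ * (2 * R) ^ h.degree := by
  have hcard : h.toPolynomial.roots.card = h.degree :=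
    ((IsAlgClosed.splits _).natDegree_eq_card_roots).symm
  have hprod : ∀ z, ‖h.eval z‖ = ‖h.toPolynomial.leadingCoeff‖ *
      ‖(h.toPolynomial.roots.map fun u => z - u).prod‖ := fun z => by
    rw [← norm_mul]
    exact congrArg _ ((IsAlgClosed.splits h.toPolynomial).eval_eq_prod_roots z)
  have hnR : ‖((R : ℝ) : ℂ)‖ = R := by rw [Complex.norm_real, Real.norm_of_nonneg hR]
  have hnT : ‖((T : ℝ) : ℂ)‖ = T := by
    rw [Complex.norm_real, Real.norm_of_nonneg (hR.trans hRT)]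
  have h1 := (multiset_prod_sub_bounds _ hroots (z := (R : ℂ)) hnR.ge).1
  have h2 := (multiset_prod_sub_bounds _ hroots (z := (T : ℂ)) (by rw [hnT]; linarith)).2
  rw [hcard, hnR, ← two_mul] at h1
  rw [hcard, hnT] at h2
  rw [hprod, hprod, mul_assoc, mul_assoc]
  refine mul_le_mul_of_nonneg_left ?_ (norm_nonneg _)
  rw [mul_comm]
  exact mul_le_mul h2 h1 (norm_nonneg _) (norm_nonneg _)

/-- Polynomials uniformly close to `g` on the sphere have the degree of `g`, and coefficients close
to those of `g`. The degree cannot jump: the zeros of `h` stay in a fixed disc, so the growth of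
`h` between two circles outside that disc reveals its degree, while `h` is close to `g` on both. -/
theorem Poly.exists_chord_lt_imp_coeff (g : Poly) {η : ℝ} (hη : 0 < η) :
    ∃ ε > 0, ∀ h : Poly, (∀ z, halfChord (g.sphereMap z) (h.sphereMap z) < ε) →
      h.degree = g.degree ∧ ∀ k, ‖h.toPolynomial.coeff k - g.toPolynomial.coeff k‖ ≤ η := by
  set n := g.degree with hn
  have hn0 : 0 < n := g.natDegree_pos
  have hm : 0 < ‖g.toPolynomial.coeff n‖ := g.leadingCoeff_norm_pos
  set m := ‖g.toPolynomial.coeff n‖ with hmdef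
  obtain ⟨C, hC0, hC⟩ := g.exists_norm_coeff_le
  -- `R` bounds the points where `g` is small
  set R : ℝ := 1 + 2 / m + 2 * n * C / m with hR
  have hR1 : 1 ≤ R := by
    have : 0 ≤ 2 / m + 2 * n * C / m := by positivity
    linarith
  have hgR : ∀ z : ℂ, R ≤ ‖z‖ → 1 ≤ ‖g.eval z‖ := by
    intro z hz
    have e1 : 2 * n * C / m ≤ ‖z‖ := by
      have : 0 ≤ 1 + 2 / m := by positivity
      linarith
    have e2 : 2 / m ≤ ‖z‖ := by
      have : 0 ≤ 1 + 2 * n * C / m := by positivity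
      linarith
    rw [div_le_iff₀' hm] at e1 e2
    have e3 := le_norm_eval_of_coeff_le (p := g.toPolynomial) hn0 le_rfl le_rfl (fun k _ => hC k)
      (hR1.trans hz) e1
    have e4 : ‖z‖ ≤ ‖z‖ ^ n := le_self_pow₀ (hR1.trans hz) hn0.ne'
    change 1 ≤ ‖g.toPolynomial.eval z‖
    nlinarith
  set C' : ℝ := (n + 1) * C + 1 with hC'
  have hC'0 : 0 < C' := by positivity
  -- `T` is so large that a degree of at least `n + 1` would make `h` grow too much from `R` to `T`
  set T : ℝ := 2 * C' * (4 * R) ^ (n + 1) + 3 * R + 1 with hT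
  have hTR : 3 * R + 1 ≤ T := by
    have : 0 ≤ 2 * C' * (4 * R) ^ (n + 1) := by positivity
    linarith
  have hT1 : 1 ≤ T := by linarith
  have hgT : ∀ z : ℂ, ‖z‖ ≤ T → ‖g.eval z‖ ≤ (n + 1) * C * T ^ n := fun z hz =>
    norm_eval_le_of_coeff_le le_rfl hC hT1 hz
  set M : ℝ := (n + 1) * C * T ^ n with hM
  set μ : ℝ := min (1 / 2) (min η (m / 2)) with hμ
  have hμ0 : 0 < μ := by positivity
  have hμ1 : μ ≤ 1 / 2 := min_le_left _ _
  have hμη : μ ≤ η := (min_le_right _ _).trans (min_le_left _ _)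
  have hμm : μ ≤ m / 2 := (min_le_right _ _).trans (min_le_right _ _)
  refine ⟨μ / (2 * (1 + M ^ 2)), by positivity, fun h hh => ?_⟩
  set ε := μ / (2 * (1 + M ^ 2)) with hε
  have hε0 : 0 < ε := by positivity
  have hεM : 2 * ε * (1 + M ^ 2) = μ := by rw [hε]; field_simp
  have hεs : ε * √(1 + M ^ 2) ≤ 1 / 2 := by
    have h1 : √(1 + M ^ 2) ≤ 1 + M ^ 2 := by
      rw [Real.sqrt_le_left (by positivity)]
      nlinarith [sq_nonneg M]
    nlinarith
  have hε1 : ε ≤ 1 / 4 := by nlinarith [sq_nonneg M]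
  have hclose : ∀ z : ℂ, ‖z‖ ≤ T → ‖h.eval z - g.eval z‖ ≤ μ := fun z hz => by
    have h1 := norm_sub_le_of_halfChord_lt (hgT z hz) hεs (hh z)
    rwa [hεM] at h1
  have hcoeff : ∀ k, ‖h.toPolynomial.coeff k - g.toPolynomial.coeff k‖ ≤ μ := fun k => by
    rw [← Polynomial.coeff_sub]
    refine norm_coeff_le_of_norm_eval_le (fun z hz => ?_) k
    rw [Polynomial.eval_sub]
    exact hclose z (by rw [hz]; exact hT1)
  refine ⟨le_antisymm ?_ ?_, fun k => (hcoeff k).trans hμη⟩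
  · -- the zeros of `h` lie in the disc of radius `R`
    have hroots : ∀ u ∈ h.toPolynomial.roots, ‖u‖ ≤ R := by
      intro u hu
      have hu0 : h.eval u = 0 := Polynomial.isRoot_of_mem_roots hu
      by_contra hc
      -- the chord from `g u` to `h u = 0` is short, so `g u` is small
      have h1 := hgR u (not_le.1 hc).le
      have h2 := hh u
      rw [sphereMap_coe, sphereMap_coe, hu0, halfChord_coe_coe, sub_zero, norm_zero,
        div_lt_iff₀ (by positivity)] at h2
      have h3 : √(1 + ‖g.eval u‖ ^ 2) ≤ 2 * ‖g.eval u‖ := by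
        rw [Real.sqrt_le_left (by positivity)]
        nlinarith
      simp only [ne_eq, OfNat.ofNat_ne_zero, not_false_eq_true, zero_pow, add_zero, Real.sqrt_one,
        mul_one] at h2
      nlinarith
    by_contra hc
    have hN : n + 1 ≤ h.degree := not_le.1 hc
    set N := h.degree
    have hnR : ‖((R : ℝ) : ℂ)‖ = R := by
      rw [Complex.norm_real, Real.norm_of_nonneg (by linarith)]
    have hnT : ‖((T : ℝ) : ℂ)‖ = T := by
      rw [Complex.norm_real, Real.norm_of_nonneg (by linarith)]
    have b0 : ‖h.eval (R : ℂ)‖ * (T - R) ^ N ≤ ‖h.eval (T : ℂ)‖ * (2 * R) ^ N :=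
      h.norm_eval_mul_pow_le (by linarith) (by linarith) hroots
    have b1 : 1 / 2 ≤ ‖h.eval (R : ℂ)‖ := by
      have h2 := hgR (R : ℂ) hnR.ge
      have h3 := hclose (R : ℂ) (by rw [hnR]; linarith)
      have h4 := norm_sub_norm_le (g.eval (R : ℂ)) (h.eval (R : ℂ))
      rw [norm_sub_rev] at h4
      linarith
    have b2 : ‖h.eval (T : ℂ)‖ ≤ C' * T ^ n := by
      have h2 := hgT (T : ℂ) hnT.le
      have h3 := hclose (T : ℂ) hnT.le
      have h4 := norm_sub_norm_le (h.eval (T : ℂ)) (g.eval (T : ℂ))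
      have h7 : 1 ≤ T ^ n := one_le_pow₀ hT1
      have h8 : C' * T ^ n = M + T ^ n := by rw [hC', hM]; ring
      linarith
    set q := (T - R) / (2 * R) with hq
    have hq1 : 1 ≤ q := by rw [hq, le_div_iff₀ (by positivity)]; linarith
    have b3 : q ^ N ≤ 2 * (C' * T ^ n) := by
      rw [hq, div_pow, div_le_iff₀ (by positivity)]
      have h1 : 0 ≤ (T - R) ^ N := pow_nonneg (by linarith) _
      have h2 : 0 ≤ (2 * R) ^ N := by positivity
      have h3 := mul_le_mul_of_nonneg_right b1 h1
      have h4 := mul_le_mul_of_nonneg_right b2 h2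
      linarith
    have b4 : q ^ (n + 1) ≤ 2 * (C' * T ^ n) := (pow_le_pow_right₀ hq1 hN).trans b3
    have b5 : T / (4 * R) ≤ q := by
      rw [hq, div_le_div_iff₀ (by positivity) (by positivity)]
      have h1 : 0 ≤ R * (T - 2 * R) := mul_nonneg (by linarith) (by linarith)
      linarith
    have b6 : (T / (4 * R)) ^ (n + 1) ≤ 2 * (C' * T ^ n) :=
      (pow_le_pow_left₀ (by positivity) b5 _).trans b4
    rw [div_pow, div_le_iff₀ (by positivity), pow_succ] at b6
    have b7 : T ≤ 2 * C' * (4 * R) ^ (n + 1) := by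
      have : 0 < T ^ n := by positivity
      refine le_of_mul_le_mul_left ?_ this
      linarith
    linarith
  · refine Polynomial.le_natDegree_of_ne_zero fun h0 => ?_
    have h1 := hcoeff n
    rw [h0, zero_sub, norm_neg] at h1
    linarith

/-- The polynomials of the degree of `g` whose coefficients differ by at most `η` from those of
`g`. -/
def Poly.coeffNhd (g : Poly) (η : ℝ) : Set Poly :=
  {h | h.degree = g.degree ∧ ∀ k, ‖h.toPolynomial.coeff k - g.toPolynomial.coeff k‖ ≤ η}

theorem Poly.exists_coeff_imp_chord_lt (g : Poly) {ε : ℝ} (hε : 0 < ε) :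
    ∃ η > 0, ∀ h ∈ g.coeffNhd η, ∀ z, halfChord (g.sphereMap z) (h.sphereMap z) < ε := by
  set n := g.degree with hn
  have hn0 : 0 < n := g.natDegree_pos
  have hm : 0 < ‖g.toPolynomial.coeff n‖ := g.leadingCoeff_norm_pos
  set m := ‖g.toPolynomial.coeff n‖ with hmdef
  obtain ⟨C, hC0, hC⟩ := g.exists_norm_coeff_le
  set T : ℝ := 1 + 16 / (m * ε) + 4 * n * (C + m / 2) / m with hT
  have hT1 : 1 ≤ T := by
    have : 0 ≤ 16 / (m * ε) + 4 * n * (C + m / 2) / m := by positivity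
    linarith
  have hTε : 16 / (m * ε) ≤ T := by
    have : 0 ≤ 1 + 4 * n * (C + m / 2) / m := by positivity
    linarith
  have hTC : 4 * n * (C + m / 2) / m ≤ T := by
    have : 0 ≤ 1 + 16 / (m * ε) := by positivity
    linarith
  rw [div_le_iff₀ (by positivity)] at hTε hTC
  set η := min (m / 2) (ε / (2 * ((n + 1) * T ^ n))) with hη
  have hη0 : 0 < η := by positivity
  have hηm : η ≤ m / 2 := min_le_left _ _
  have hηε : η * (2 * ((n + 1) * T ^ n)) ≤ ε := by
    rw [← le_div_iff₀ (by positivity)]; exact min_le_right _ _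
  -- all these polynomials are large outside the disc of radius `T`
  have hbig : ∀ h ∈ g.coeffNhd η, ∀ z : ℂ, T ≤ ‖z‖ → 4 / ε ≤ ‖h.eval z‖ := by
    rintro h ⟨hd, hc⟩ z hz
    have h1 : m / 2 ≤ ‖h.toPolynomial.coeff n‖ := by
      have := norm_sub_norm_le (g.toPolynomial.coeff n) (h.toPolynomial.coeff n)
      rw [norm_sub_rev] at this
      linarith [hc n]
    have h2 : ∀ k < n, ‖h.toPolynomial.coeff k‖ ≤ C + m / 2 := fun k _ => by
      have := norm_sub_norm_le (h.toPolynomial.coeff k) (g.toPolynomial.coeff k)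
      linarith [hc k, hC k]
    have h3 := le_norm_eval_of_coeff_le hn0 (le_of_eq hd) h1 h2 (hT1.trans hz) (by nlinarith)
    have h4 : ‖z‖ ≤ ‖z‖ ^ n := le_self_pow₀ (hT1.trans hz) hn0.ne'
    refine le_trans ?_ h3
    rw [div_le_iff₀ hε]
    have h5 : m / 2 / 2 * T * ε ≤ m / 2 / 2 * ‖z‖ ^ n * ε := by gcongr; linarith
    nlinarith
  refine ⟨η, hη0, fun h hh z => ?_⟩
  induction z using OnePoint.rec
  · rwa [sphereMap_infty, sphereMap_infty, halfChord_self]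
  · rename_i z
    rw [sphereMap_coe, sphereMap_coe]
    rcases le_total T ‖z‖ with hz | hz
    · have h1 := hbig h hh z hz
      have h2 := hbig g ⟨rfl, fun k => by simpa using hη0.le⟩ z hz
      have h3 := halfChord_coe_infty_le (by positivity) h1
      have h4 := halfChord_coe_infty_le (by positivity) h2
      have h5 := halfChord_triangle (g.eval z : Sphere) ∞ (h.eval z : Sphere)
      rw [halfChord_comm ∞] at h5
      rw [one_div_div] at h3 h4
      linarith
    · refine (halfChord_coe_coe_le _ _).trans_lt ?_
      have h1 := norm_eval_le_of_coeff_le (p := h.toPolynomial - g.toPolynomial) (n := n) (C := η)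
        ((Polynomial.natDegree_sub_le _ _).trans (max_le hh.1.le le_rfl))
        (fun k => by rw [Polynomial.coeff_sub]; exact hh.2 k) hT1 hz
      rw [Polynomial.eval_sub, norm_sub_rev] at h1
      change ‖g.eval z - h.eval z‖ ≤ _ at h1
      linarith

theorem bddAbove_range_sphericalDist (g h : Poly) :
    BddAbove (Set.range fun z => sphericalDist (g.sphereMap z) (h.sphereMap z)) := by
  refine ⟨Real.pi, ?_⟩
  rintro _ ⟨z, rfl⟩
  refine (sphericalDist_le_pi_mul _ _).trans ?_
  nlinarith [halfChord_le_one (g.sphereMap z) (h.sphereMap z), Real.pi_pos]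

theorem halfChord_lt_of_unifDist_lt {g h : Poly} {ε : ℝ} (hgh : Poly.unifDist g h < 2 * ε)
    (z : Sphere) : halfChord (g.sphereMap z) (h.sphereMap z) < ε := by
  have h1 := le_ciSup (bddAbove_range_sphericalDist g h) z
  have h2 := two_mul_halfChord_le (g.sphereMap z) (h.sphereMap z)
  have h3 : (⨆ z, sphericalDist (g.sphereMap z) (h.sphereMap z)) < 2 * ε := hgh
  linarith

theorem unifDist_le_of_halfChord_le {g h : Poly} {ε : ℝ}
    (hgh : ∀ z, halfChord (g.sphereMap z) (h.sphereMap z) ≤ ε) :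
    Poly.unifDist g h ≤ Real.pi * ε :=
  ciSup_le fun z => (sphericalDist_le_pi_mul _ _).trans
    (mul_le_mul_of_nonneg_left (hgh z) Real.pi_pos.le)

theorem chord_lt_mem_nhds (g : Poly) {ε : ℝ} (hε : 0 < ε) :
    {h : Poly | ∀ z, halfChord (g.sphereMap z) (h.sphereMap z) < ε} ∈ 𝓝 g := by
  let U : Set Poly := {h | ∃ ε' < ε, ∀ z, halfChord (g.sphereMap z) (h.sphereMap z) ≤ ε'}
  have hU : IsOpen U := by
    rintro h ⟨ε', hε', hh⟩
    refine ⟨2 * ((ε - ε') / 2), by linarith, fun k hk => ⟨(ε + ε') / 2, by linarith, fun z => ?_⟩⟩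
    have h1 := halfChord_lt_of_unifDist_lt hk z
    have h2 := halfChord_triangle (g.sphereMap z) (h.sphereMap z) (k.sphereMap z)
    linarith [hh z]
  have hg : g ∈ U := ⟨0, hε, fun z => (halfChord_self _).le⟩
  refine mem_of_superset (hU.mem_nhds hg) ?_
  rintro h ⟨ε', hε', hh⟩ z
  exact (hh z).trans_lt hε'

theorem Poly.coeffNhd_mem_nhds (g : Poly) {η : ℝ} (hη : 0 < η) : g.coeffNhd η ∈ 𝓝 g := by
  obtain ⟨ε, hε, h⟩ := g.exists_chord_lt_imp_coeff hη
  exact mem_of_superset (chord_lt_mem_nhds g hε) h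

theorem Poly.isCompact_coeffNhd (g : Poly) {η : ℝ} (hη : η < ‖g.toPolynomial.coeff g.degree‖) :
    IsCompact (g.coeffNhd η) := by
  set n := g.degree with hn
  let c₀ : Fin (n + 1) → ℂ := fun k => g.toPolynomial.coeff k
  let K : Set (Fin (n + 1) → ℂ) := Set.pi Set.univ fun k => closedBall (c₀ k) η
  have hK : IsCompact K := isCompact_univ_pi fun k => isCompact_closedBall _ _
  have hdeg : ∀ c ∈ K, (Polynomial.ofFn (n + 1) c).natDegree = n := by
    intro c hc
    refine le_antisymm (Nat.lt_succ_iff.1 (Polynomial.ofFn_natDegree_lt (by omega) c))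
      (Polynomial.le_natDegree_of_ne_zero ?_)
    rw [Polynomial.ofFn_coeff_eq_val_of_lt _ (Nat.lt_succ_self n)]
    intro h0
    have h1 := hc (⟨n, Nat.lt_succ_self n⟩) trivial
    rw [mem_closedBall, h0, dist_zero_left] at h1
    exact absurd h1 (not_le.2 hη)
  let Φ : K → Poly := fun c => ⟨Polynomial.ofFn (n + 1) c.1, by
    rw [hdeg _ c.2]; exact g.natDegree_pos⟩
  have hΦcoeff : ∀ (c c' : K) (k : ℕ), ‖(Φ c).toPolynomial.coeff k - (Φ c').toPolynomial.coeff k‖ ≤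
      dist c c' := by
    intro c c' k
    by_cases hk : k < n + 1
    · change ‖(Polynomial.ofFn (n + 1) c.1).coeff k - (Polynomial.ofFn (n + 1) c'.1).coeff k‖ ≤ _
      rw [Polynomial.ofFn_coeff_eq_val_of_lt _ hk, Polynomial.ofFn_coeff_eq_val_of_lt _ hk,
        ← dist_eq_norm]
      exact dist_le_pi_dist c.1 c'.1 _
    · change ‖(Polynomial.ofFn (n + 1) c.1).coeff k - (Polynomial.ofFn (n + 1) c'.1).coeff k‖ ≤ _
      rw [Polynomial.ofFn_coeff_eq_zero_of_ge _ (by omega),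
        Polynomial.ofFn_coeff_eq_zero_of_ge _ (by omega), sub_zero, norm_zero]
      exact dist_nonneg
  have hΦ : Continuous Φ := by
    rw [continuous_iff_continuousAt]
    intro c s hs
    obtain ⟨U, hUs, hU, hcU⟩ := mem_nhds_iff.1 hs
    obtain ⟨ε, hε, hεU⟩ := hU _ hcU
    obtain ⟨η', hη', h⟩ :=
      (Φ c).exists_coeff_imp_chord_lt (div_pos hε (mul_pos two_pos Real.pi_pos))
    refine mem_map.2 (mem_of_superset (ball_mem_nhds c hη') fun c' hc' => hUs (hεU _ ?_))
    refine (unifDist_le_of_halfChord_le fun z => (h (Φ c') ⟨?_, fun k => ?_⟩ z).le).trans_lt ?_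
    · exact (hdeg _ c'.2).trans (hdeg _ c.2).symm
    · exact (hΦcoeff c' c k).trans (mem_ball.1 hc').le
    · have := Real.pi_pos
      rw [mul_div_assoc', div_lt_iff₀ (by positivity)]
      nlinarith
  have := isCompact_iff_compactSpace.1 hK
  convert isCompact_range hΦ
  ext h
  constructor
  · rintro ⟨hd, hc⟩
    refine ⟨⟨fun k => h.toPolynomial.coeff k, fun k _ => ?_⟩, ?_⟩
    · rw [mem_closedBall, dist_eq_norm]; exact hc k
    · ext k
      change (Polynomial.ofFn (n + 1) _).coeff k = _
      by_cases hk : k < n + 1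
      · rw [Polynomial.ofFn_coeff_eq_val_of_lt _ hk]
      · rw [Polynomial.ofFn_coeff_eq_zero_of_ge _ (by omega),
          Polynomial.coeff_eq_zero_of_natDegree_lt]
        have : h.toPolynomial.natDegree = n := hd
        omega
  · rintro ⟨c, rfl⟩
    refine ⟨hdeg _ c.2, fun k => ?_⟩
    change ‖(Polynomial.ofFn (n + 1) c.1).coeff k - _‖ ≤ η
    have hη0 : 0 ≤ η := dist_nonneg.trans (c.2 0 trivial)
    by_cases hk : k < n + 1
    · rw [Polynomial.ofFn_coeff_eq_val_of_lt _ hk, ← dist_eq_norm]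
      exact c.2 ⟨k, hk⟩ trivial
    · rw [Polynomial.ofFn_coeff_eq_zero_of_ge _ (by omega),
        Polynomial.coeff_eq_zero_of_natDegree_lt (p := g.toPolynomial), sub_zero, norm_zero]
      · exact hη0
      · have : g.toPolynomial.natDegree = n := rfl
        omega

/-- The members of degree at least `e` of a compact set of polynomials grow uniformly at least
like the power `e`. -/
theorem exists_uniform_growth {Γ : Set Poly} (hΓ : IsCompact Γ) (b : ℂ) (e : ℕ) :
    ∃ κ > 0, ∃ R : ℝ, ∀ h ∈ Γ, e ≤ h.degree → ∀ z, R ≤ ‖z - b‖ →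
      κ * ‖z - b‖ ^ e ≤ ‖h.eval z - b‖ := by
  refine hΓ.induction_on (p := fun s => ∃ κ > 0, ∃ R : ℝ, ∀ h ∈ s, e ≤ h.degree →
    ∀ z, R ≤ ‖z - b‖ → κ * ‖z - b‖ ^ e ≤ ‖h.eval z - b‖) ⟨1, one_pos, 0, by simp⟩ ?_ ?_ ?_
  · rintro s t hst ⟨κ, hκ, R, h⟩
    exact ⟨κ, hκ, R, fun g hg => h g (hst hg)⟩
  · rintro s t ⟨κ₁, hκ₁, R₁, h₁⟩ ⟨κ₂, hκ₂, R₂, h₂⟩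
    refine ⟨min κ₁ κ₂, lt_min hκ₁ hκ₂, max R₁ R₂, ?_⟩
    rintro g (hg | hg) he z hz
    · refine le_trans ?_ (h₁ g hg he z ((le_max_left _ _).trans hz))
      gcongr
      exact min_le_left _ _
    · refine le_trans ?_ (h₂ g hg he z ((le_max_right _ _).trans hz))
      gcongr
      exact min_le_right _ _
  · intro g _
    have hn0 : 0 < g.degree := g.natDegree_pos
    have hm : 0 < ‖g.toPolynomial.coeff g.degree‖ := g.leadingCoeff_norm_pos
    set n := g.degree with hn
    set m := ‖g.toPolynomial.coeff n‖ with hmdef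
    obtain ⟨C, hC0, hC⟩ := g.exists_norm_coeff_le
    set C' : ℝ := C + m / 2 + ‖b‖ with hC'
    refine ⟨_, mem_nhdsWithin_of_mem_nhds (g.coeffNhd_mem_nhds (half_pos hm)), m / 4 / 2 ^ e,
      by positivity, 2 * ‖b‖ + 2 + 2 * (4 * n * C' / m), ?_⟩
    rintro h ⟨hd, hc⟩ he z hz
    rw [hd] at he
    have hz0 : ‖z - b‖ ≤ ‖z‖ + ‖b‖ := norm_sub_le _ _
    have hq : 0 ≤ 4 * n * C' / m := by positivity
    have hz1 : 1 ≤ ‖z‖ := by linarith [norm_nonneg b]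
    have hz2 : 4 * n * C' / m ≤ ‖z‖ := by linarith [norm_nonneg b]
    have hz3 : ‖z - b‖ / 2 ≤ ‖z‖ := by linarith [norm_nonneg b]
    rw [div_le_iff₀ hm] at hz2
    have h1 : m / 2 ≤ ‖(h.toPolynomial - Polynomial.C b).coeff n‖ := by
      rw [Polynomial.coeff_sub, Polynomial.coeff_C_of_ne_zero hn0.ne', sub_zero]
      have := norm_sub_norm_le (g.toPolynomial.coeff n) (h.toPolynomial.coeff n)
      rw [norm_sub_rev] at this
      linarith [hc n]
    have h2 : ∀ k < n, ‖(h.toPolynomial - Polynomial.C b).coeff k‖ ≤ C' := fun k _ => by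
      have e1 := norm_sub_norm_le (h.toPolynomial.coeff k) (g.toPolynomial.coeff k)
      have e2 : ‖(Polynomial.C b).coeff k‖ ≤ ‖b‖ := by
        rw [Polynomial.coeff_C]
        split_ifs
        · exact le_rfl
        · simp
      rw [Polynomial.coeff_sub]
      have e3 := norm_sub_le (h.toPolynomial.coeff k) ((Polynomial.C b).coeff k)
      linarith [hc k, hC k]
    have h3 := le_norm_eval_of_coeff_le hn0 (by rw [Polynomial.natDegree_sub_C]; exact hd.le) h1 h2
      hz1 (by nlinarith)
    rw [Polynomial.eval_sub, Polynomial.eval_C] at h3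
    refine le_trans ?_ h3
    calc m / 4 / 2 ^ e * ‖z - b‖ ^ e = m / 4 * (‖z - b‖ / 2) ^ e := by rw [div_pow]; ring
      _ ≤ m / 4 * ‖z‖ ^ e := by gcongr
      _ ≤ m / 4 * ‖z‖ ^ n := by gcongr
      _ = m / 2 / 2 * ‖z‖ ^ n := by ring

/-! ### Smallest filled-in Julia sets and postcritical sets -/

theorem Poly.eval_mul (g h : Poly) (z : ℂ) : (g * h).eval z = g.eval (h.eval z) :=
  Polynomial.eval_comp

theorem Poly.degree_mul (g h : Poly) : (g * h).degree = g.degree * h.degree :=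
  Polynomial.natDegree_comp

theorem Poly.eval_derivative_mul (g h : Poly) (z : ℂ) :
    (g * h).toPolynomial.derivative.eval z =
      h.toPolynomial.derivative.eval z * g.toPolynomial.derivative.eval (h.eval z) := by
  change ((g.toPolynomial.comp h.toPolynomial).derivative).eval z = _
  rw [Polynomial.derivative_comp, Polynomial.eval_mul, Polynomial.eval_comp]
  rfl

theorem Poly.planeCriticalValues_mul_subset (g h : Poly) : (g * h).planeCriticalValues ⊆
    g.planeCriticalValues ∪ g.eval '' h.planeCriticalValues := by
  rintro _ ⟨z, hz, rfl⟩
  rw [Set.mem_ofPred_eq, eval_derivative_mul, mul_eq_zero] at hz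
  rw [eval_mul]
  rcases hz with hz | hz
  · exact Or.inr ⟨_, ⟨z, hz, rfl⟩, rfl⟩
  · exact Or.inl ⟨_, hz, rfl⟩

theorem Poly.image_planeCriticalValues_subset_mul (g h : Poly) :
    g.eval '' h.planeCriticalValues ⊆ (g * h).planeCriticalValues := by
  rintro _ ⟨_, ⟨z, hz, rfl⟩, rfl⟩
  refine ⟨z, ?_, eval_mul g h z⟩
  rw [Set.mem_ofPred_eq, eval_derivative_mul, show h.toPolynomial.derivative.eval z = 0 from hz,
    zero_mul]

theorem Poly.coe_mem_criticalValues {g : Poly} {w : ℂ} :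
    (w : Sphere) ∈ g.criticalValues ↔ w ∈ g.planeCriticalValues := by
  constructor
  · rintro (⟨z, hz, h⟩ | ⟨h, -⟩)
    · exact ⟨z, hz, (OnePoint.coe_injective h).symm⟩
    · exact absurd h (OnePoint.coe_ne_infty w)
  · rintro ⟨z, hz, rfl⟩
    exact Or.inl ⟨z, hz, rfl⟩

theorem planeCriticalValues_subset_planarPostcriticalSet {G : Subsemigroup Poly} {g : Poly}
    (hg : g ∈ G) : g.planeCriticalValues ⊆ planarPostcriticalSet G := fun _ hw =>
  subset_closure (Set.mem_biUnion hg (Poly.coe_mem_criticalValues.2 hw))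

theorem isClosed_planarPostcriticalSet (G : Subsemigroup Poly) :
    IsClosed (planarPostcriticalSet G) :=
  isClosed_closure.preimage OnePoint.continuous_coe

theorem postcriticalSet_subset {G : Subsemigroup Poly} {T : Set ℂ} (hT : IsCompact T)
    (h : ∀ g ∈ G, g.planeCriticalValues ⊆ T) : postcriticalSet G ⊆ {∞} ∪ ((↑) '' T) := by
  refine closure_minimal (Set.iUnion₂_subset fun g hg => ?_)
    (isClosed_singleton.union (OnePoint.isClosed_image_coe.2 ⟨hT.isClosed, hT⟩))
  rintro w (⟨z, hz, rfl⟩ | ⟨rfl, -⟩)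
  · exact Or.inr ⟨_, h g hg ⟨z, hz, rfl⟩, rfl⟩
  · exact Or.inl rfl

theorem planarPostcriticalSet_subset {G : Subsemigroup Poly} {T : Set ℂ} (hT : IsCompact T)
    (h : ∀ g ∈ G, g.planeCriticalValues ⊆ T) : planarPostcriticalSet G ⊆ T := by
  intro z hz
  rcases postcriticalSet_subset hT h hz with h | ⟨w, hw, h⟩
  · exact absurd h (OnePoint.coe_ne_infty z)
  · rwa [← OnePoint.coe_injective h]

/-- Finite critical values of a postcritically bounded semigroup have bounded orbits. -/
theorem IsPostcriticallyBounded.planeCriticalValues_subset {G : Subsemigroup Poly}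
    (hG : IsPostcriticallyBounded G) {g : Poly} (hg : g ∈ G) :
    g.planeCriticalValues ⊆ smallestFilledJulia G := by
  intro c hc
  refine hG.2.subset ?_
  rintro _ ⟨f, hf, rfl⟩
  exact planeCriticalValues_subset_planarPostcriticalSet (G.mul_mem hf hg)
    (f.image_planeCriticalValues_subset_mul g ⟨c, hc, rfl⟩)

theorem mapsTo_smallestFilledJulia {G : Subsemigroup Poly} {g : Poly} (hg : g ∈ G) :
    Set.MapsTo g.eval (smallestFilledJulia G) (smallestFilledJulia G) := by
  intro z hz
  refine Bornology.IsBounded.subset (t := {w : ℂ | ∃ g ∈ G, w = g.eval z}) hz ?_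
  rintro _ ⟨f, hf, rfl⟩
  exact ⟨f * g, G.mul_mem hf hg, (f.eval_mul g z).symm⟩

theorem smallestFilledJulia_anti {G H : Subsemigroup Poly} (h : G ≤ H) :
    smallestFilledJulia H ⊆ smallestFilledJulia G := by
  intro z hz
  refine Bornology.IsBounded.subset (t := {w : ℂ | ∃ g ∈ H, w = g.eval z}) hz ?_
  rintro _ ⟨f, hf, rfl⟩
  exact ⟨f, h hf, rfl⟩

/-- Points whose orbits stay in a bounded set belong to the smallest filled-in Julia set. -/
theorem mem_smallestFilledJulia_of_mapsTo {G : Subsemigroup Poly} {S K : Set ℂ}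
    (hK : Bornology.IsBounded K) (h : ∀ g ∈ G, Set.MapsTo g.eval S K) :
    S ⊆ smallestFilledJulia G := by
  intro z hz
  refine hK.subset ?_
  rintro _ ⟨f, hf, rfl⟩
  exact h f hf hz

theorem norm_sub_le_of_mem_generated {Γ : Set Poly} {b : ℂ} {R : ℝ}
    (hexp : ∀ h ∈ Γ, ∀ z, R < ‖z - b‖ → ‖z - b‖ ≤ ‖h.eval z - b‖) :
    ∀ g ∈ generated Γ, ∀ z, R < ‖z - b‖ → ‖z - b‖ ≤ ‖g.eval z - b‖ := by
  intro g hg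
  induction hg using Subsemigroup.closure_induction with
  | mem g hg => exact hexp g hg
  | mul f g _ _ hf hg =>
    intro z hz
    have h1 := hg z hz
    rw [Poly.eval_mul]
    exact h1.trans (hf _ (hz.trans_le h1))

theorem smallestFilledJulia_subset_closedBall {Γ : Set Poly} (hne : Γ.Nonempty) {b : ℂ} {R : ℝ}
    (hR : 0 ≤ R) (hexp : ∀ h ∈ Γ, ∀ z, R < ‖z - b‖ → 3 / 2 * ‖z - b‖ ≤ ‖h.eval z - b‖) :
    smallestFilledJulia (generated Γ) ⊆ closedBall b R := by
  intro w hw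
  rw [mem_closedBall, dist_eq_norm]
  by_contra hc
  rw [not_le] at hc
  obtain ⟨h, hh⟩ := hne
  have key : ∀ n : ℕ, ∃ f ∈ generated Γ, (3 / 2 : ℝ) ^ n * ‖w - b‖ ≤ ‖f.eval w - b‖ := by
    intro n
    induction n with
    | zero =>
      refine ⟨h, Subsemigroup.subset_closure hh, ?_⟩
      have := hexp h hh w hc
      rw [pow_zero, one_mul]
      linarith [norm_nonneg (w - b)]
    | succ n ih =>
      obtain ⟨f, hf, hfw⟩ := ih
      refine ⟨h * f, Subsemigroup.mul_mem _ (Subsemigroup.subset_closure hh) hf, ?_⟩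
      have h1 : 1 * ‖w - b‖ ≤ (3 / 2 : ℝ) ^ n * ‖w - b‖ := by
        gcongr
        exact one_le_pow₀ (by norm_num)
      have h2 := hexp h hh (f.eval w) (by linarith)
      rw [Poly.eval_mul, pow_succ]
      linarith
  obtain ⟨M, hM⟩ := Bornology.IsBounded.exists_norm_le
    (s := {z : ℂ | ∃ g ∈ generated Γ, z = g.eval w}) hw
  have hpos : 0 < ‖w - b‖ := hR.trans_lt hc
  obtain ⟨n, hn⟩ := ((tendsto_pow_atTop_atTop_of_one_lt (by norm_num : (1 : ℝ) < 3 / 2)).eventually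
    (eventually_gt_atTop ((M + ‖b‖) / ‖w - b‖))).exists
  obtain ⟨f, hf, hfw⟩ := key n
  rw [div_lt_iff₀ hpos] at hn
  have h1 := norm_sub_le (f.eval w) b
  have h2 := hM _ ⟨f, hf, rfl⟩
  linarith

theorem isClosed_smallestFilledJulia {Γ : Set Poly} (hne : Γ.Nonempty) {b : ℂ} {R : ℝ}
    (hR : 0 ≤ R) (hexp : ∀ h ∈ Γ, ∀ z, R < ‖z - b‖ → 3 / 2 * ‖z - b‖ ≤ ‖h.eval z - b‖) :
    IsClosed (smallestFilledJulia (generated Γ)) := by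
  have hsub := smallestFilledJulia_subset_closedBall hne hR hexp
  have : smallestFilledJulia (generated Γ) =
      ⋂ g ∈ generated Γ, g.eval ⁻¹' closedBall b R := by
    refine Set.Subset.antisymm ?_ ?_
    · exact fun z hz => Set.mem_iInter₂.2 fun g hg => hsub (mapsTo_smallestFilledJulia hg hz)
    · exact mem_smallestFilledJulia_of_mapsTo isBounded_closedBall
        fun g hg z hz => Set.mem_iInter₂.1 hz g hg
  rw [this]
  exact isClosed_biInter fun g _ => isClosed_closedBall.preimage g.continuous_eval

theorem coe_mem_juliaSet_of_notMem_interior {G : Subsemigroup Poly} {z : ℂ}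
    (hz : z ∈ smallestFilledJulia G) (hz' : z ∉ interior (smallestFilledJulia G)) :
    (z : Sphere) ∈ juliaSet G :=
  fun h => hz' (mem_interior_of_mem_fatouSet G hz h)

theorem exists_coe_mem_juliaSet {Γ : Set Poly} (hne : Γ.Nonempty) {b : ℂ} {R : ℝ}
    (hR : 0 ≤ R) (hexp : ∀ h ∈ Γ, ∀ z, R < ‖z - b‖ → 3 / 2 * ‖z - b‖ ≤ ‖h.eval z - b‖)
    (hK : (smallestFilledJulia (generated Γ)).Nonempty) :
    ∃ z ∈ smallestFilledJulia (generated Γ), z ∉ interior (smallestFilledJulia (generated Γ)) ∧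
      (z : Sphere) ∈ juliaSet (generated Γ) := by
  have hcl := isClosed_smallestFilledJulia hne hR hexp
  have hsub := smallestFilledJulia_subset_closedBall hne hR hexp
  obtain ⟨z, hz⟩ := nonempty_frontier_iff.2 ⟨hK, fun h => by
    have h1 : IsCompact (Set.univ : Set ℂ) := (isCompact_closedBall b R).of_isClosed_subset
      isClosed_univ (h ▸ hsub)
    exact noncompact_univ ℂ h1⟩
  rw [hcl.frontier_eq] at hz
  exact ⟨z, hz.1, hz.2, coe_mem_juliaSet_of_notMem_interior hz.1 hz.2⟩

/-! ### Enlarging a polynomial semigroup -/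

/-- The configuration in which the family `Γ` is enlarged by a family `W`: outside the disc
`‖z - b‖ ≤ R` all generators expand the distance to `b`, while those in `W` squeeze the smallest
filled-in Julia set of `⟨Γ⟩`, and have their finite critical values, in the disc
`‖z - b‖ ≤ r` well inside its interior. -/
structure IsSqueezingExtension (Γ W : Set Poly) (b : ℂ) (r R : ℝ) : Prop where
  nonempty : Γ.Nonempty
  r_pos : 0 < r
  norm_lt : ‖b‖ < R
  expand : ∀ h ∈ Γ ∪ W, ∀ z, R < ‖z - b‖ → 3 / 2 * ‖z - b‖ ≤ ‖h.eval z - b‖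
  closedBall_subset : closedBall b (3 * r) ⊆ smallestFilledJulia (generated Γ)
  critical : ∀ f ∈ generated Γ, f.planeCriticalValues ⊆ smallestFilledJulia (generated Γ)
  mapsTo : ∀ g ∈ W, Set.MapsTo g.eval (smallestFilledJulia (generated Γ)) (closedBall b r)
  critical_right : ∀ g ∈ W, g.planeCriticalValues ⊆ closedBall b r

namespace IsSqueezingExtension

variable {Γ W : Set Poly} {b : ℂ} {r R : ℝ}

theorem R_nonneg (A : IsSqueezingExtension Γ W b r R) : 0 ≤ R :=
  (norm_nonneg b).trans A.norm_lt.le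

theorem generated_le : generated Γ ≤ generated (Γ ∪ W) :=
  Subsemigroup.closure_mono Set.subset_union_left

theorem isClosed (A : IsSqueezingExtension Γ W b r R) :
    IsClosed (smallestFilledJulia (generated Γ)) :=
  isClosed_smallestFilledJulia A.nonempty A.R_nonneg fun h hh => A.expand h (Or.inl hh)

theorem subset_closedBall (A : IsSqueezingExtension Γ W b r R) :
    smallestFilledJulia (generated Γ) ⊆ closedBall b R :=
  smallestFilledJulia_subset_closedBall A.nonempty A.R_nonneg fun h hh => A.expand h (Or.inl hh)

theorem isCompact (A : IsSqueezingExtension Γ W b r R) :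
    IsCompact (smallestFilledJulia (generated Γ)) :=
  (isCompact_closedBall b R).of_isClosed_subset A.isClosed A.subset_closedBall

theorem closedBall_subset' (A : IsSqueezingExtension Γ W b r R) :
    closedBall b r ⊆ smallestFilledJulia (generated Γ) :=
  (closedBall_subset_closedBall (by linarith [A.r_pos])).trans A.closedBall_subset

theorem norm_le (A : IsSqueezingExtension Γ W b r R) :
    ∀ g ∈ generated (Γ ∪ W), ∀ z, R < ‖z - b‖ → ‖z - b‖ ≤ ‖g.eval z - b‖ :=
  norm_sub_le_of_mem_generated fun h hh z hz => by
    linarith [A.expand h hh z hz, norm_nonneg (z - b)]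

theorem mapsTo_of_mem (A : IsSqueezingExtension Γ W b r R) :
    ∀ f ∈ generated (Γ ∪ W), Set.MapsTo f.eval (smallestFilledJulia (generated Γ))
      (smallestFilledJulia (generated Γ)) := by
  intro f hf
  induction hf using Subsemigroup.closure_induction with
  | mem f hf =>
    rcases hf with hf | hf
    · exact mapsTo_smallestFilledJulia (Subsemigroup.subset_closure hf)
    · exact (A.mapsTo f hf).mono_right A.closedBall_subset'
  | mul f g _ _ hf hg =>
    intro z hz
    rw [Poly.eval_mul]
    exact hf (hg hz)

theorem smallestFilledJulia_eq (A : IsSqueezingExtension Γ W b r R) :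
    smallestFilledJulia (generated (Γ ∪ W)) = smallestFilledJulia (generated Γ) :=
  Set.Subset.antisymm (smallestFilledJulia_anti generated_le)
    (mem_smallestFilledJulia_of_mapsTo A.isCompact.isBounded A.mapsTo_of_mem)

/-- The finite critical values of `q` lie in `closedBall b r`, and so does the image of the smallest
filled-in Julia set of `⟨Γ⟩`: the property shared by the words whose outermost letter is in `W`. -/
def Squeezes (Γ : Set Poly) (b : ℂ) (r : ℝ) (q : Poly) : Prop :=
  q.planeCriticalValues ⊆ closedBall b r ∧
    Set.MapsTo q.eval (smallestFilledJulia (generated Γ)) (closedBall b r)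

/-- The words in `Γ ∪ W`, sorted by the position of the outermost letter from `W`. -/
theorem trichotomy (A : IsSqueezingExtension Γ W b r R) :
    ∀ f ∈ generated (Γ ∪ W), f.planeCriticalValues ⊆ smallestFilledJulia (generated Γ) ∧
      (f ∈ generated Γ ∨ Squeezes Γ b r f ∨
        ∃ p ∈ generated Γ, ∃ q, Squeezes Γ b r q ∧ f = p * q) := by
  intro f hf
  induction hf using Subsemigroup.closure_induction with
  | mem f hf =>
    rcases hf with hf | hf
    · exact ⟨A.critical f (Subsemigroup.subset_closure hf), Or.inl (Subsemigroup.subset_closure hf)⟩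
    · exact ⟨(A.critical_right f hf).trans A.closedBall_subset',
        Or.inr (Or.inl ⟨A.critical_right f hf, A.mapsTo f hf⟩)⟩
  | mul f g hf' hg' hf hg =>
    have hcv : (f * g).planeCriticalValues ⊆ smallestFilledJulia (generated Γ) := by
      refine (f.planeCriticalValues_mul_subset g).trans (Set.union_subset hf.1 ?_)
      exact Set.image_subset_iff.2 (hg.1.trans (A.mapsTo_of_mem f hf'))
    have hsq : ∀ q, Squeezes Γ b r q → Squeezes Γ b r (q * g) := by
      rintro q ⟨h1, h2⟩
      refine ⟨(q.planeCriticalValues_mul_subset g).trans (Set.union_subset h1 ?_), fun z hz => ?_⟩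
      · exact Set.image_subset_iff.2 (hg.1.trans h2)
      · rw [Poly.eval_mul]
        exact h2 (A.mapsTo_of_mem g hg' hz)
    refine ⟨hcv, ?_⟩
    rcases hf.2 with hf1 | hf1 | ⟨p, hp, q, hq, rfl⟩
    · rcases hg.2 with hg1 | hg1 | ⟨p, hp, q, hq, rfl⟩
      · exact Or.inl (Subsemigroup.mul_mem _ hf1 hg1)
      · exact Or.inr (Or.inr ⟨f, hf1, g, hg1, rfl⟩)
      · exact Or.inr (Or.inr ⟨f * p, Subsemigroup.mul_mem _ hf1 hp, q, hq, (mul_assoc f p q).symm⟩)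
    · exact Or.inr (Or.inl (hsq f hf1))
    · exact Or.inr (Or.inr ⟨p, hp, q * g, hsq q hq, mul_assoc p q g⟩)

theorem isPostcriticallyBounded (A : IsSqueezingExtension Γ W b r R)
    (hdeg : Γ ∪ W ⊆ polyDegGeTwo) : IsPostcriticallyBounded (generated (Γ ∪ W)) := by
  refine ⟨fun f hf => ?_, A.isCompact.isBounded.subset
    (planarPostcriticalSet_subset A.isCompact fun f hf => (A.trichotomy f hf).1)⟩
  induction hf using Subsemigroup.closure_induction with
  | mem f hf => exact hdeg hf
  | mul f g _ _ hf hg =>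
    rw [Poly.degree_mul]
    nlinarith

theorem interior_subset_fatouSet (A : IsSqueezingExtension Γ W b r R) {z : ℂ}
    (hz : z ∈ interior (smallestFilledJulia (generated Γ))) :
    (z : Sphere) ∈ fatouSet (generated (Γ ∪ W)) :=
  coe_mem_fatouSet_of_mapsTo _ A.isCompact.isBounded A.mapsTo_of_mem hz

theorem infty_mem_fatouSet (A : IsSqueezingExtension Γ W b r R) :
    ∞ ∈ fatouSet (generated (Γ ∪ W)) :=
  PolySemigroup.infty_mem_fatouSet _ A.norm_lt A.norm_le

theorem exists_of_mem_juliaSet (A : IsSqueezingExtension Γ W b r R) {x : Sphere}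
    (hx : x ∈ juliaSet (generated (Γ ∪ W))) : ∃ y : ℂ, x = y ∧ y ∈ closedBall b R ∧
      y ∉ interior (smallestFilledJulia (generated Γ)) := by
  induction x using OnePoint.rec
  · exact absurd A.infty_mem_fatouSet hx
  · rename_i y
    refine ⟨y, rfl, ?_, fun h => hx (A.interior_subset_fatouSet h)⟩
    rw [mem_closedBall, dist_eq_norm]
    by_contra hc
    exact hx (coe_mem_fatouSet_of_expanding _ A.norm_lt A.norm_le (not_le.1 hc))

/-- A ring which `Γ` throws outside the disc of radius `R` and `W` throws into the smallest
filled-in Julia set lies in the Fatou set; it separates the Julia set of `⟨Γ⟩` from points of the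
Julia set of any element of `W`. -/
theorem not_isPreconnected_juliaSet (A : IsSqueezingExtension Γ W b r R) (hW : W.Nonempty)
    {M₁ M₂ : ℝ} (hM : M₁ < M₂) (hK : smallestFilledJulia (generated Γ) ⊆ closedBall b M₁)
    (hΓ : ∀ h ∈ Γ, ∀ z, M₁ < ‖z - b‖ → R < ‖h.eval z - b‖)
    (hWb : ∀ g ∈ W, Set.MapsTo g.eval (ball b M₂) (closedBall b r)) :
    ¬ IsPreconnected (juliaSet (generated (Γ ∪ W))) := by
  intro hpre
  set S : Set ℂ := {z | M₁ < ‖z - b‖ ∧ ‖z - b‖ < M₂} with hS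
  have hSo : IsOpen S := (isOpen_lt continuous_const (by fun_prop)).and
    (isOpen_lt (by fun_prop) continuous_const)
  obtain ⟨M, hMK⟩ := A.isCompact.isBounded.exists_norm_le
  have hdich : ∀ f ∈ generated (Γ ∪ W),
      (∀ z ∈ S, f.eval z ∈ smallestFilledJulia (generated Γ)) ∨
      (∀ z ∈ S, R < ‖f.eval z - b‖) := by
    intro f hf
    induction hf using Subsemigroup.closure_induction with
    | mem f hf =>
      rcases hf with hf | hf
      · exact Or.inr fun z hz => hΓ f hf z hz.1
      · refine Or.inl fun z hz => A.closedBall_subset' (hWb f hf ?_)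
        rw [mem_ball, dist_eq_norm]
        exact hz.2
    | mul f g hf' _ _ hg =>
      simp only [Poly.eval_mul]
      rcases hg with hg | hg
      · exact Or.inl fun z hz => A.mapsTo_of_mem f hf' (hg z hz)
      · exact Or.inr fun z hz => (hg z hz).trans_le (A.norm_le f hf' _ (hg z hz))
  have hSF : ∀ z ∈ S, (z : Sphere) ∈ fatouSet (generated (Γ ∪ W)) := fun z hz =>
    coe_mem_fatouSet_of_dichotomy _ hSo (M := M) (m := R - ‖b‖) (by linarith [A.norm_lt])
      (fun f hf => (hdich f hf).imp (fun h z hz => hMK _ (h z hz)) fun h z hz => by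
        linarith [h z hz, norm_sub_le (f.eval z) b]) hz
  have hU : IsOpen ((↑) '' ball b M₂ : Set Sphere) :=
    OnePoint.isOpenEmbedding_coe.isOpenMap _ isOpen_ball
  have hV : IsOpen ((↑) '' closedBall b M₁ : Set Sphere)ᶜ :=
    OnePoint.isOpen_compl_image_coe.2 ⟨isClosed_closedBall, isCompact_closedBall _ _⟩
  have hcb : closedBall b M₁ ⊆ ball b M₂ := closedBall_subset_ball hM
  have h₁ : (juliaSet (generated (Γ ∪ W)) ∩ (↑) '' ball b M₂).Nonempty := by
    obtain ⟨z, hz, -, hzJ⟩ := exists_coe_mem_juliaSet A.nonempty A.R_nonneg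
      (fun h hh => A.expand h (Or.inl hh))
      ⟨b, A.closedBall_subset' (mem_closedBall_self A.r_pos.le)⟩
    exact ⟨z, juliaSet_mono generated_le hzJ, z, hcb (hK hz), rfl⟩
  have h₂ : (juliaSet (generated (Γ ∪ W)) ∩ ((↑) '' closedBall b M₁)ᶜ).Nonempty := by
    obtain ⟨g, hg⟩ := hW
    -- the filled-in Julia set of `g` contains the disc of radius `M₂`
    have hsub : ball b M₂ ⊆ smallestFilledJulia (generated {g}) := by
      refine mem_smallestFilledJulia_of_mapsTo (K := ball b M₂) isBounded_ball fun f hf => ?_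
      induction hf using Subsemigroup.closure_induction with
      | mem f hf =>
        rw [Set.mem_singleton_iff.1 hf]
        exact (hWb g hg).mono_right (A.closedBall_subset'.trans (hK.trans hcb))
      | mul f g _ _ hf hg =>
        intro z hz
        rw [Poly.eval_mul]
        exact hf (hg hz)
    have hbM : b ∈ ball b M₂ :=
      hcb (hK (A.closedBall_subset' (mem_closedBall_self A.r_pos.le)))
    obtain ⟨z, -, hz, hzJ⟩ := exists_coe_mem_juliaSet (Set.singleton_nonempty g) A.R_nonneg
      (fun h hh => by
        rw [Set.mem_singleton_iff.1 hh]
        exact A.expand g (Or.inr hg)) ⟨b, hsub hbM⟩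
    refine ⟨z, juliaSet_mono (Subsemigroup.closure_mono
      (Set.singleton_subset_iff.2 (Or.inr hg))) hzJ, ?_⟩
    rintro ⟨w, hw, hwz⟩
    rw [OnePoint.coe_injective hwz] at hw
    exact hz (interior_maximal hsub isOpen_ball (hcb hw))
  obtain ⟨x, hx, ⟨z, hz, rfl⟩, hx2⟩ := hpre _ _ hU hV
    (fun x _ => by
      by_cases hx : x ∈ ((↑) '' closedBall b M₁ : Set Sphere)
      · exact Or.inl (Set.image_mono hcb hx)
      · exact Or.inr hx) h₁ h₂
  refine hx (hSF z ⟨?_, by rwa [← dist_eq_norm]⟩)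
  by_contra hc
  exact hx2 ⟨z, by rw [mem_closedBall, dist_eq_norm]; exact not_lt.1 hc, rfl⟩

/-! ### Hyperbolicity and semi-hyperbolicity -/

/-- If the elements of `⟨Γ⟩` have bounded degree over a disc whose centre is not interior to the
smallest filled-in Julia set `K`, then the components of the preimages of a smaller disc are small
and far from `b`: a component near `b` would lie in `K`, and so would its image. -/
theorem exists_radius (A : IsSqueezingExtension Γ W b r R) (N : ℕ) {δ : ℝ} (hδ : 0 < δ) :
    ∃ δ' > 0, δ' ≤ δ ∧ ∀ y ∈ closedBall b R, y ∉ interior (smallestFilledJulia (generated Γ)) →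
      ∀ p ∈ generated Γ, DegreeAtMost p (ball y δ) N → ∀ C : Set ℂ, IsPreconnected C →
      Set.MapsTo p.eval C (ball y δ') → ∀ x ∈ C, C ⊆ ball x r ∧
        Disjoint (ball x r) (closedBall b r) := by
  obtain ⟨δ', hδ', hle, h⟩ := exists_radius_preimage_small b (R + δ) N hδ A.r_pos
  refine ⟨δ', hδ', hle, fun y hy hyK p hp hN C hC hCp x hx => ?_⟩
  have hR : ∀ z, p.eval z ∈ ball y δ → dist z b ≤ R + δ := by
    intro z hz
    by_contra hc
    rw [not_le, dist_eq_norm] at hc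
    have h1 := A.norm_le p (generated_le hp) z (by linarith)
    rw [mem_ball] at hz
    rw [mem_closedBall] at hy
    have h2 := dist_triangle (p.eval z) y b
    rw [dist_eq_norm _ b] at h2
    linarith
  refine ⟨h p y hR hN C hC hCp x hx, ?_⟩
  rw [Set.disjoint_left]
  intro u hu hub
  refine hyK (interior_maximal ?_ isOpen_ball (mem_ball_self hδ'))
  have hsub : connectedComponentIn (p.eval ⁻¹' ball y δ') x ⊆
      smallestFilledJulia (generated Γ) := by
    refine (h p y hR hN _ isPreconnected_connectedComponentIn
      (connectedComponentIn_subset (p.eval ⁻¹' ball y δ') x) x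
      (mem_connectedComponentIn (hCp hx))).trans (fun z hz => A.closedBall_subset ?_)
    rw [mem_closedBall] at hub ⊢
    rw [mem_ball] at hu hz
    have h1 := dist_triangle4 z x u b
    rw [dist_comm x u] at h1
    linarith
  exact (p.ball_subset_image_connectedComponentIn (hCp hx)).trans
    (Set.image_subset_iff.2 (hsub.trans (mapsTo_smallestFilledJulia hp)))

theorem isHyperbolic (A : IsSqueezingExtension Γ W b r R) (hG : IsHyperbolic (generated Γ)) :
    IsHyperbolic (generated (Γ ∪ W)) := by
  set K := smallestFilledJulia (generated Γ) with hKdef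
  set P := planarPostcriticalSet (generated Γ) with hP
  have hPK : P ⊆ K := planarPostcriticalSet_subset A.isCompact A.critical
  have hPc : IsCompact P :=
    A.isCompact.of_isClosed_subset (isClosed_planarPostcriticalSet _) hPK
  have hPint : P ⊆ interior K := fun z hz => mem_interior_of_mem_fatouSet _ (hPK hz) (hG hz)
  obtain ⟨δ, hδ, hthick⟩ := hPc.exists_thickening_subset_open isOpen_interior hPint
  have hdeg : ∀ y, y ∉ interior K → ∀ p ∈ generated Γ, DegreeAtMost p (ball y δ) 1 := by
    intro y hy p hp
    refine degreeAtMost_one p (Set.disjoint_left.2 fun w hw hw' => hy (hthick ?_))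
    refine mem_thickening_iff.2
      ⟨w, planeCriticalValues_subset_planarPostcriticalSet hp hw', ?_⟩
    rwa [dist_comm]
  obtain ⟨δ', hδ', -, hrad⟩ := A.exists_radius 1 hδ
  -- the orbit of `closedBall b r` under `⟨Γ⟩` stays away from the boundary of `K`
  set O : Set ℂ := K ∩ ⋂ y ∈ closedBall b R \ interior K, {x | δ' ≤ dist x y} with hO
  have hOc : IsCompact O := A.isCompact.inter_right
    (isClosed_biInter fun y _ => isClosed_le continuous_const (by fun_prop))
  have hOint : O ⊆ interior K := by
    rintro x ⟨hx, hx'⟩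
    by_contra hc
    have := Set.mem_iInter₂.1 hx' x ⟨A.subset_closedBall hx, hc⟩
    rw [Set.mem_ofPred_eq, dist_self] at this
    linarith
  have horb : ∀ p ∈ generated Γ, p.eval '' closedBall b r ⊆ O := by
    rintro p hp _ ⟨z, hz, rfl⟩
    refine ⟨mapsTo_smallestFilledJulia hp (A.closedBall_subset' hz),
      Set.mem_iInter₂.2 fun y hy => ?_⟩
    by_contra hc
    have h1 := hrad y hy.1 hy.2 p hp (hdeg y hy.2 p hp) {z} isPreconnected_singleton
      (Set.mapsTo_singleton.2 (mem_ball.2 (not_le.1 hc))) z rfl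
    exact Set.disjoint_left.1 h1.2 (mem_ball_self A.r_pos) hz
  have hb : closedBall b r ⊆ interior K :=
    (closedBall_subset_ball (by linarith [A.r_pos])).trans
      (interior_maximal (ball_subset_closedBall.trans A.closedBall_subset) isOpen_ball)
  refine (postcriticalSet_subset (T := P ∪ closedBall b r ∪ O)
    ((hPc.union (isCompact_closedBall b r)).union hOc) fun f hf => ?_).trans ?_
  · rcases (A.trichotomy f hf).2 with h | h | ⟨p, hp, q, hq, rfl⟩
    · exact (planeCriticalValues_subset_planarPostcriticalSet h).trans
        (Set.subset_union_left.trans Set.subset_union_left)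
    · exact h.1.trans (Set.subset_union_right.trans Set.subset_union_left)
    · refine (p.planeCriticalValues_mul_subset q).trans (Set.union_subset ?_ ?_)
      · exact (planeCriticalValues_subset_planarPostcriticalSet hp).trans
          (Set.subset_union_left.trans Set.subset_union_left)
      · exact (Set.image_mono hq.1).trans ((horb p hp).trans Set.subset_union_right)
  · rintro _ (rfl | ⟨z, hz, rfl⟩)
    · exact A.infty_mem_fatouSet
    · exact A.interior_subset_fatouSet (Set.union_subset (Set.union_subset hPint hb) hOint hz)

end IsSqueezingExtension

/-- The bound on covering degrees over a spherical disc gives one over a Euclidean disc. -/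
theorem degreeAtMost_of_coveringDegree_le {g : Poly} {y : ℂ} {δ : ℝ} {N : ℕ}
    (h : ∀ x ∈ g.sphereMap ⁻¹' sphericalBall y δ,
      coveringDegree g (connectedComponentIn (g.sphereMap ⁻¹' sphericalBall y δ) x)
        (sphericalBall y δ) ≤ N) : DegreeAtMost g (ball y (δ / Real.pi)) N := by
  intro C hC hCg w
  rcases (C ∩ g.eval ⁻¹' {w}).eq_empty_or_nonempty with he | ⟨x, hxC, hxw⟩
  · rw [he, Set.encard_empty]
    exact zero_le
  have hball : ∀ u ∈ ball y (δ / Real.pi), (u : Sphere) ∈ sphericalBall y δ := by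
    intro u hu
    rw [mem_ball, dist_eq_norm, lt_div_iff₀' Real.pi_pos] at hu
    refine (sphericalDist_le_pi_mul _ _).trans_lt (lt_of_le_of_lt ?_ hu)
    exact mul_le_mul_of_nonneg_left (halfChord_coe_coe_le u y) Real.pi_pos.le
  have hsub : ((↑) : ℂ → Sphere) '' C ⊆
      connectedComponentIn (g.sphereMap ⁻¹' sphericalBall y δ) (x : Sphere) := by
    refine (hC.image _ OnePoint.continuous_coe.continuousOn).subset_connectedComponentIn
      ⟨x, hxC, rfl⟩ ?_
    rintro _ ⟨u, hu, rfl⟩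
    exact hball _ (hCg hu)
  have hx := h x (hball _ (hCg hxC))
  rw [← OnePoint.coe_injective.injOn.encard_image (s := C ∩ g.eval ⁻¹' {w})]
  refine le_trans (le_trans (Set.encard_le_encard ?_)
    (le_iSup₂ (f := fun w (_ : w ∈ sphericalBall y δ) =>
      (connectedComponentIn (g.sphereMap ⁻¹' sphericalBall y δ) (x : Sphere) ∩
        g.sphereMap ⁻¹' {w}).encard) (w : Sphere) ?_)) hx
  · rintro _ ⟨u, ⟨hu, huw⟩, rfl⟩
    refine ⟨hsub ⟨u, hu, rfl⟩, ?_⟩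
    rw [Set.mem_preimage, Poly.sphereMap_coe, show g.eval u = w from huw]
    rfl
  · rw [← show g.eval x = w from hxw]
    exact hball _ (hCg hxC)

theorem exists_sphericalBall_subset (M : ℝ) {δ : ℝ} (hδ : 0 < δ) : ∃ δ' > 0, ∀ y : ℂ, ‖y‖ ≤ M →
    sphericalBall y δ' ⊆ (↑) '' ball y δ := by
  set μ := min (1 / 2) (δ / 2) with hμ
  have hμ0 : 0 < μ := by positivity
  set ε := μ / (2 * (1 + M ^ 2)) with hε
  have hε0 : 0 < ε := by positivity
  have hεM : 2 * ε * (1 + M ^ 2) = μ := by rw [hε]; field_simp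
  have hμ1 : μ ≤ 1 / 2 := min_le_left _ _
  have hμ2 : μ ≤ δ / 2 := min_le_right _ _
  have hεs : ε * √(1 + M ^ 2) ≤ 1 / 2 := by
    have h1 : √(1 + M ^ 2) ≤ 1 + M ^ 2 := by
      rw [Real.sqrt_le_left (by positivity)]
      nlinarith [sq_nonneg M]
    nlinarith
  refine ⟨2 * ε, by positivity, fun y hy x hx => ?_⟩
  have hx' : halfChord (y : Sphere) x < ε := by
    rw [halfChord_comm]
    have h1 := two_mul_halfChord_le x y
    have h2 : sphericalDist x y < 2 * ε := hx
    linarith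
  induction x using OnePoint.rec
  · rw [halfChord_coe_infty, div_lt_iff₀ (by positivity)] at hx'
    have h1 : √(1 + ‖y‖ ^ 2) ≤ √(1 + M ^ 2) := Real.sqrt_le_sqrt (by gcongr)
    nlinarith
  · rename_i u
    refine ⟨u, ?_, rfl⟩
    have h1 := norm_sub_le_of_halfChord_lt hy hεs hx'
    rw [mem_ball, dist_eq_norm]
    linarith

theorem coveringDegree_le_of_degreeAtMost {g : Poly} {y : ℂ} {δ δ' : ℝ} {N : ℕ}
    (hsub : sphericalBall y δ' ⊆ (↑) '' ball y δ) (h : DegreeAtMost g (ball y δ) N) (x : Sphere) :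
    coveringDegree g (connectedComponentIn (g.sphereMap ⁻¹' sphericalBall y δ') x)
      (sphericalBall y δ') ≤ N := by
  set V := connectedComponentIn (g.sphereMap ⁻¹' sphericalBall y δ') x with hV
  have hVs : V ⊆ g.sphereMap ⁻¹' sphericalBall y δ' := connectedComponentIn_subset _ _
  have hVr : V ⊆ Set.range ((↑) : ℂ → Sphere) := by
    intro u hu
    induction u using OnePoint.rec
    · obtain ⟨w, -, hw⟩ := hsub (hVs hu)
      exact absurd hw (OnePoint.coe_ne_infty w)
    · exact ⟨_, rfl⟩
  have hpre : IsPreconnected (((↑) : ℂ → Sphere) ⁻¹' V) :=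
    isPreconnected_connectedComponentIn.preimage_of_isOpenMap OnePoint.coe_injective
      OnePoint.isOpenEmbedding_coe.isOpenMap hVr
  have hmaps : Set.MapsTo g.eval (((↑) : ℂ → Sphere) ⁻¹' V) (ball y δ) := by
    intro u hu
    obtain ⟨w, hw, hwu⟩ := hsub (hVs hu)
    rw [Poly.sphereMap_coe] at hwu
    rwa [← OnePoint.coe_injective hwu]
  refine iSup₂_le fun w hw => ?_
  obtain ⟨w, -, rfl⟩ := hsub hw
  refine le_trans (le_trans (Set.encard_le_encard ?_) (OnePoint.coe_injective.injOn.encard_image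
    (s := ((↑) : ℂ → Sphere) ⁻¹' V ∩ g.eval ⁻¹' {w})).le) (h _ hpre hmaps w)
  rintro u ⟨hu, huw⟩
  obtain ⟨u, rfl⟩ := hVr hu
  exact ⟨u, ⟨hu, OnePoint.coe_injective huw⟩, rfl⟩

namespace IsSqueezingExtension

variable {Γ W : Set Poly} {b : ℂ} {r R : ℝ}

/-- A word `p ∘ q`, with `p` in `⟨Γ⟩` of bounded degree over a disc at the boundary of the
smallest filled-in Julia set and `q` beginning with a letter of `W`, has bounded degree over a
smaller disc: the components for `p` are contained in discs without critical values of `q`. -/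
theorem isSemiHyperbolic (A : IsSqueezingExtension Γ W b r R)
    (hG : IsSemiHyperbolic (generated Γ)) : IsSemiHyperbolic (generated (Γ ∪ W)) := by
  obtain ⟨δs, hδs, N, hN⟩ := hG
  set K := smallestFilledJulia (generated Γ) with hKdef
  set δ := δs / Real.pi / 2 with hδdef
  have hδ : 0 < δ := by have := Real.pi_pos; positivity
  have hN' : ∀ y : ℂ, (y : Sphere) ∈ juliaSet (generated Γ) → ∀ p ∈ generated Γ,
      DegreeAtMost p (ball y (2 * δ)) N := by
    intro y hy p hp
    have := degreeAtMost_of_coveringDegree_le (hN y hy p hp)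
    rwa [hδdef, mul_div_cancel₀ _ two_ne_zero]
  obtain ⟨δ', hδ', hle, hrad⟩ := A.exists_radius N hδ
  have hmin : 0 < min δ' r := lt_min hδ' A.r_pos
  have key : ∀ y ∈ closedBall b R, y ∉ interior K → ∀ f ∈ generated (Γ ∪ W),
      DegreeAtMost f (ball y (min δ' r)) (max N 1) := by
    intro y hyR hyK f hf
    have hsub1 : ball y (min δ' r) ⊆ ball y δ' := ball_subset_ball (min_le_left _ _)
    have hsub2 : ball y (min δ' r) ⊆ ball y δ := ball_subset_ball ((min_le_left _ _).trans hle)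
    by_cases hnear : ∃ y₁ : ℂ, (y₁ : Sphere) ∈ juliaSet (generated Γ) ∧ dist y y₁ < δ
    · obtain ⟨y₁, hy₁, hd⟩ := hnear
      have hsub : ball y δ ⊆ ball y₁ (2 * δ) := ball_subset_ball' (by linarith)
      have hdeg : ∀ p ∈ generated Γ, DegreeAtMost p (ball y δ) N := fun p hp =>
        (hN' y₁ hy₁ p hp).mono hsub le_rfl
      rcases (A.trichotomy f hf).2 with h | h | ⟨p, hp, q, hq, rfl⟩
      · exact (hdeg f h).mono hsub2 (le_max_left _ _)
      · refine (degreeAtMost_one f ?_).mono subset_rfl (le_max_right _ _)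
        rw [Set.disjoint_left]
        intro w hw hw'
        have hw'' := h.1 hw'
        refine hyK (interior_maximal (ball_subset_closedBall.trans A.closedBall_subset)
          isOpen_ball ?_)
        rw [mem_closedBall] at hw''
        rw [mem_ball] at hw ⊢
        have h1 := dist_triangle_left y b w
        have h2 : min δ' r ≤ r := min_le_right _ _
        linarith [A.r_pos]
      · intro C hC hCf w
        refine le_trans ?_ (Nat.cast_le.2 (le_max_left N 1))
        rcases C.eq_empty_or_nonempty with rfl | ⟨x, hx⟩
        · simp
        have hC' : IsPreconnected (q.eval '' C) := hC.image _ q.continuous_eval.continuousOn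
        have hmaps : Set.MapsTo p.eval (q.eval '' C) (ball y δ') := by
          rintro _ ⟨u, hu, rfl⟩
          rw [← Poly.eval_mul]
          exact hsub1 (hCf hu)
        obtain ⟨h1, h2⟩ := hrad y hyR hyK p hp (hdeg p hp) _ hC' hmaps _ ⟨x, hx, rfl⟩
        have hinj : Set.InjOn q.eval C := q.injOn_of_disjoint_planeCriticalValues
          (h2.mono_right hq.1) hC (Set.mapsTo_iff_image_subset.2 h1)
        rw [← (hinj.mono Set.inter_subset_left).encard_image (s := C ∩ (p * q).eval ⁻¹' {w})]
        refine (Set.encard_le_encard ?_).trans (hdeg p hp _ hC'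
          (hmaps.mono_right (ball_subset_ball hle)) w)
        rintro _ ⟨u, ⟨hu, huw⟩, rfl⟩
        refine ⟨⟨u, hu, rfl⟩, ?_⟩
        rw [Set.mem_preimage, ← Poly.eval_mul]
        exact huw
    · -- the disc does not meet the smallest filled-in Julia set, whose boundary is in `J`
      refine (degreeAtMost_one f (Set.disjoint_of_subset hsub2 (A.trichotomy f hf).1 ?_)).mono
        subset_rfl (le_max_right _ _)
      have hcases := isPreconnected_iff_subset_of_disjoint.1 (convex_ball y δ).isPreconnected
        (interior K) Kᶜ isOpen_interior A.isClosed.isOpen_compl (fun z hz => by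
          by_cases hzK : z ∈ K
          · by_contra hc
            exact hnear ⟨z, coe_mem_juliaSet_of_notMem_interior hzK fun h => hc (Or.inl h),
              by rwa [dist_comm]⟩
          · exact Or.inr hzK) (by
          rw [Set.eq_empty_iff_forall_notMem]
          rintro z ⟨-, hz1, hz2⟩
          exact hz2 (interior_subset hz1))
      rcases hcases with h | h
      · exact absurd (h (mem_ball_self hδ)) hyK
      · exact Set.disjoint_left.2 fun z hz => h hz
  obtain ⟨ε, hε, hsph⟩ := exists_sphericalBall_subset (R + ‖b‖) hmin
  refine ⟨ε, hε, max N 1, fun x hx f hf u _ => ?_⟩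
  obtain ⟨y, rfl, hyR, hyK⟩ := A.exists_of_mem_juliaSet hx
  refine coveringDegree_le_of_degreeAtMost (hsph y ?_) (key y hyR hyK f hf) u
  rw [mem_closedBall, dist_eq_norm] at hyR
  have := norm_sub_norm_le y b
  linarith

end IsSqueezingExtension

/-! ### Neighbourhoods of the power maps -/

section PowerMap

variable {a b : ℂ} {d : ℕ} (ha : a ≠ 0) (hd : 2 ≤ d)

theorem degree_powerMap : (powerMap a b d ha hd).degree = d := by
  change (Polynomial.C a * (Polynomial.X - Polynomial.C b) ^ d + Polynomial.C b).natDegree = d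
  rw [Polynomial.natDegree_add_C, Polynomial.natDegree_C_mul ha, Polynomial.natDegree_pow,
    Polynomial.natDegree_X_sub_C, mul_one]

theorem eval_powerMap (z : ℂ) : (powerMap a b d ha hd).eval z = a * (z - b) ^ d + b := by
  simp [Poly.eval, powerMap]

theorem eval_derivative_powerMap (z : ℂ) :
    (powerMap a b d ha hd).toPolynomial.derivative.eval z = a * (d * (z - b) ^ (d - 1)) := by
  simp [powerMap, Polynomial.derivative_pow]

theorem coeff_powerMap :
    (powerMap a b d ha hd).toPolynomial.coeff (powerMap a b d ha hd).degree = a := by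
  change (Polynomial.C a * (Polynomial.X - Polynomial.C b) ^ d + Polynomial.C b).leadingCoeff = a
  rw [Polynomial.leadingCoeff_add_of_degree_lt']
  · rw [Polynomial.leadingCoeff_mul, Polynomial.leadingCoeff_C, Polynomial.leadingCoeff_pow,
      Polynomial.leadingCoeff_X_sub_C, one_pow, mul_one]
  · refine Polynomial.degree_C_le.trans_lt ?_
    rw [Polynomial.degree_mul, Polynomial.degree_C ha, Polynomial.degree_pow,
      Polynomial.degree_X_sub_C, zero_add, nsmul_eq_mul, mul_one]
    exact_mod_cast (by omega : 0 < d)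

variable {ha hd} {g : Poly} {η : ℝ}

theorem norm_eval_sub_powerMap_le (hg : g ∈ (powerMap a b d ha hd).coeffNhd η) {z : ℂ} {T : ℝ}
    (hT : 1 ≤ T) (hz : ‖z‖ ≤ T) :
    ‖g.eval z - (powerMap a b d ha hd).eval z‖ ≤ (d + 1) * η * T ^ d := by
  have h1 := norm_eval_le_of_coeff_le
    (p := g.toPolynomial - (powerMap a b d ha hd).toPolynomial) (n := d) (C := η)
    ((Polynomial.natDegree_sub_le _ _).trans (max_le (hg.1.trans (degree_powerMap ha hd)).le
      (degree_powerMap ha hd).le)) (fun k => by rw [Polynomial.coeff_sub]; exact hg.2 k) hT hz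
  rwa [Polynomial.eval_sub] at h1

theorem norm_eval_derivative_sub_powerMap_le (hg : g ∈ (powerMap a b d ha hd).coeffNhd η) {z : ℂ}
    {T : ℝ} (hT : 1 ≤ T) (hz : ‖z‖ ≤ T) :
    ‖g.toPolynomial.derivative.eval z - (powerMap a b d ha hd).toPolynomial.derivative.eval z‖ ≤
      d * (d * η) * T ^ (d - 1) := by
  have hη : 0 ≤ η := (norm_nonneg _).trans (hg.2 0)
  have hdeg : (g.toPolynomial - (powerMap a b d ha hd).toPolynomial).natDegree ≤ d :=
    (Polynomial.natDegree_sub_le _ _).trans (max_le (hg.1.trans (degree_powerMap ha hd)).le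
      (degree_powerMap ha hd).le)
  have h1 := norm_eval_le_of_coeff_le
    (p := (g.toPolynomial - (powerMap a b d ha hd).toPolynomial).derivative) (n := d - 1)
    (C := d * η) ((Polynomial.natDegree_derivative_le _).trans (Nat.sub_le_sub_right hdeg 1))
    (fun k => by
      rw [Polynomial.coeff_derivative, norm_mul]
      by_cases hk : k + 1 ≤ d
      · have h2 : ‖((k : ℂ) + 1)‖ ≤ d := by
          rw [← Nat.cast_succ, Complex.norm_natCast]
          exact_mod_cast hk
        rw [Polynomial.coeff_sub, mul_comm]
        exact mul_le_mul h2 (hg.2 _) (norm_nonneg _) (Nat.cast_nonneg d)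
      · rw [Polynomial.coeff_eq_zero_of_natDegree_lt (by omega), norm_zero, zero_mul]
        positivity) hT hz
  rw [Polynomial.derivative_sub, Polynomial.eval_sub] at h1
  refine h1.trans (le_of_eq ?_)
  have : ((d - 1 : ℕ) : ℝ) + 1 = d := by
    rw [Nat.cast_sub (by omega)]
    ring
  rw [this]

/-- Near `powerMap a b d`, maps behave like it: they send a disc into a small one, expand near
infinity, and have their critical points near `b`. -/
theorem coeffNhd_powerMap_bounds {r M : ℝ} (hM : 1 ≤ M)
    (hη₁ : (d + 1) * η * (‖b‖ + 1 + M) ^ d ≤ r / 2)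
    (hη₂ : (d + 1) * η * (‖b‖ + 2) ^ d ≤ ‖a‖ / 4) (haM : ‖a‖ * M ^ d ≤ r / 2)
    (hg : g ∈ (powerMap a b d ha hd).coeffNhd η) :
    Set.MapsTo g.eval (ball b M) (closedBall b r) ∧
    (∀ R, 1 ≤ R → 2 ≤ ‖a‖ * R ^ (d - 1) → ∀ z, R < ‖z - b‖ →
      3 / 2 * ‖z - b‖ ≤ ‖g.eval z - b‖) ∧
    g.planeCriticalValues ⊆ closedBall b r := by
  have hη : 0 ≤ η := (norm_nonneg _).trans (hg.2 0)
  have ha0 : 0 < ‖a‖ := norm_pos_iff.2 ha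
  have hmaps : Set.MapsTo g.eval (ball b M) (closedBall b r) := by
    intro z hz
    rw [mem_ball, dist_eq_norm] at hz
    rw [mem_closedBall, dist_eq_norm]
    have hzb := norm_sub_norm_le z b
    have h1 := norm_eval_sub_powerMap_le hg (z := z) (T := ‖b‖ + 1 + M)
      (by linarith [norm_nonneg b]) (by linarith)
    have h2 : ‖(powerMap a b d ha hd).eval z - b‖ ≤ ‖a‖ * M ^ d := by
      rw [eval_powerMap, add_sub_cancel_right, norm_mul, norm_pow]
      gcongr
    have h3 := norm_sub_le_norm_sub_add_norm_sub (g.eval z) ((powerMap a b d ha hd).eval z) b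
    linarith
  refine ⟨hmaps, fun R hR haR z hz => ?_, ?_⟩
  · have hzb := norm_sub_norm_le z b
    have hT : ‖z‖ ≤ (‖b‖ + 2) * ‖z - b‖ := by nlinarith [norm_nonneg b]
    have h1 := norm_eval_sub_powerMap_le hg (z := z) (by nlinarith [norm_nonneg b]) hT
    rw [mul_pow, ← mul_assoc] at h1
    have h2 : ‖(powerMap a b d ha hd).eval z - b‖ = ‖a‖ * ‖z - b‖ ^ d := by
      rw [eval_powerMap, add_sub_cancel_right, norm_mul, norm_pow]
    have h3 := norm_sub_le_norm_sub_add_norm_sub ((powerMap a b d ha hd).eval z) (g.eval z) b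
    rw [norm_sub_rev _ (g.eval z)] at h3
    have h4 := mul_le_mul_of_nonneg_right hη₂ (by positivity : 0 ≤ ‖z - b‖ ^ d)
    have h5 : 2 * ‖z - b‖ ≤ ‖a‖ * ‖z - b‖ ^ d := by
      obtain ⟨k, rfl⟩ : ∃ k, d = k + 1 := ⟨d - 1, by omega⟩
      rw [Nat.add_sub_cancel] at haR
      have h6 : ‖a‖ * R ^ k ≤ ‖a‖ * ‖z - b‖ ^ k := by gcongr
      rw [pow_succ, ← mul_assoc]
      gcongr
      linarith
    linarith
  · rintro _ ⟨z, hz, rfl⟩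
    refine hmaps ?_
    rw [mem_ball, dist_eq_norm]
    by_contra hc
    have h1 : 1 ≤ ‖z - b‖ := hM.trans (not_lt.1 hc)
    have hzb := norm_sub_norm_le z b
    have hT : ‖z‖ ≤ (‖b‖ + 2) * ‖z - b‖ := by nlinarith [norm_nonneg b]
    have h2 := norm_eval_derivative_sub_powerMap_le hg (z := z) (by nlinarith [norm_nonneg b]) hT
    rw [show g.toPolynomial.derivative.eval z = 0 from hz, zero_sub, norm_neg,
      eval_derivative_powerMap, norm_mul, norm_mul, norm_pow, Complex.norm_natCast, mul_pow] at h2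
    have h3 : 0 < ‖z - b‖ ^ (d - 1) := by positivity
    have hd0 : (0 : ℝ) < d := by exact_mod_cast (by omega : 0 < d)
    have h4 : ‖a‖ ≤ d * η * (‖b‖ + 2) ^ (d - 1) := by
      refine le_of_mul_le_mul_right ?_ (mul_pos hd0 h3)
      linarith
    have h5 : d * η * (‖b‖ + 2) ^ (d - 1) ≤ (d + 1) * η * (‖b‖ + 2) ^ d := by
      gcongr
      · linarith
      · linarith [norm_nonneg b]
      · omega
    linarith

end PowerMap

/-! ### Choice of scales -/

/-- The scales of the construction, for `t = ‖a‖`. In terms of `s = t ^ (-1 / (d * e * (d - 1)))`,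
the map `powerMap a b d` escapes at scale `R ~ s ^ (d * e)`, the preimages of that scale under
polynomials of degree at least `e` lie at scale at most `M₁ ~ s ^ d`, and `powerMap a b d` is small
up to scale `M₂ ~ s ^ (d + 1)`: this leaves a ring as soon as `s` is large. -/
theorem exists_scales {κ R₁ r β : ℝ} (hκ : 0 < κ) (hr : 0 < r) (hR₁ : 1 ≤ R₁) (hβ : 0 ≤ β)
    {d e : ℕ} (hd : 2 ≤ d) (he : 2 ≤ e) (hde : d + 1 ≤ e * (d - 1)) :
    ∃ c : ℝ, 0 < c ∧ ∀ t, 0 < t → t < c → ∃ R M₁ M₂ : ℝ,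
      R₁ ≤ R ∧ β < R ∧ 2 ≤ t * R ^ (d - 1) ∧ R₁ ≤ M₁ ∧ M₁ < M₂ ∧ R < κ * M₁ ^ e ∧
      t * M₂ ^ d ≤ r / 2 := by
  set C : ℝ := 1 + 4 / κ with hC
  have hC1 : 1 ≤ C := by
    have : 0 < 4 / κ := by positivity
    linarith
  have hCe : 4 ≤ κ * C ^ e := by
    have h1 : C ≤ C ^ e := le_self_pow₀ hC1 (by omega)
    have h2 : 4 / κ ≤ C ^ e := by linarith
    rwa [div_le_iff₀' hκ] at h2
  set c' : ℝ := min 1 (r / 2) with hc'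
  have hc'0 : 0 < c' := by positivity
  have hc'1 : c' ≤ 1 := min_le_left _ _
  have hc'r : c' ≤ r / 2 := min_le_right _ _
  have hq : 0 < (C + 1) / c' := by positivity
  set s₀ : ℝ := R₁ + β + (C + 1) / c' with hs₀
  have hs₀0 : 0 < s₀ := by positivity
  set n := d * e * (d - 1) with hn
  have hn0 : n ≠ 0 := Nat.mul_ne_zero (Nat.mul_ne_zero (by omega) (by omega)) (by omega)
  refine ⟨(s₀ ^ n)⁻¹, by positivity, fun t ht htc => ?_⟩
  set s : ℝ := t⁻¹ ^ ((n : ℝ)⁻¹) with hs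
  have hs_nonneg : 0 ≤ s := by positivity
  have hsn : s ^ n = t⁻¹ := Real.rpow_inv_natCast_pow (by positivity) hn0
  have hts : t * s ^ n = 1 := by rw [hsn]; exact mul_inv_cancel₀ ht.ne'
  have hss₀ : s₀ < s := by
    refine lt_of_pow_lt_pow_left₀ n hs_nonneg ?_
    rw [hsn]
    exact (lt_inv_comm₀ ht (by positivity)).1 htc
  have hs1 : 1 ≤ s := by linarith
  have hsc : C + 1 ≤ c' * s := by
    have : (C + 1) / c' ≤ s := by linarith
    rwa [div_le_iff₀' hc'0] at this
  have hsd : s ≤ s ^ d := le_self_pow₀ hs1 (by omega)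
  have hsR : s ≤ 2 * s ^ (d * e) := by
    have h1 : s ≤ s ^ (d * e) := le_self_pow₀ hs1 (Nat.mul_ne_zero (by omega) (by omega))
    linarith
  have hCs : 1 * s ^ d ≤ C * s ^ d := by gcongr
  refine ⟨2 * s ^ (d * e), C * s ^ d, c' * s ^ (d + 1), by linarith, by linarith, ?_, by linarith,
    ?_, ?_, ?_⟩
  · have h1 : (2 : ℝ) ≤ 2 ^ (d - 1) := le_self_pow₀ one_le_two (by omega)
    have h2 : t * (2 * s ^ (d * e)) ^ (d - 1) = 2 ^ (d - 1) * (t * s ^ n) := by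
      rw [mul_pow, ← pow_mul]; ring
    rwa [h2, hts, mul_one]
  · have h1 : (C + 1) * s ^ d ≤ c' * s * s ^ d := by gcongr
    have h3 : 0 < s ^ d := by positivity
    rw [pow_succ']
    linarith
  · have h2 : κ * (C * s ^ d) ^ e = κ * C ^ e * s ^ (d * e) := by rw [mul_pow, ← pow_mul]; ring
    have h3 : 4 * s ^ (d * e) ≤ κ * C ^ e * s ^ (d * e) := by gcongr
    have h5 : 0 < s ^ (d * e) := by positivity
    linarith
  · have h1 : c' ^ d ≤ c' := pow_le_of_le_one hc'0.le hc'1 (by omega)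
    have h2 : s ^ ((d + 1) * d) ≤ s ^ n := by
      refine pow_le_pow_right₀ hs1 ?_
      rw [hn, mul_assoc, mul_comm (d + 1)]
      exact Nat.mul_le_mul_left d hde
    calc t * (c' * s ^ (d + 1)) ^ d = c' ^ d * (t * s ^ ((d + 1) * d)) := by
          rw [mul_pow, ← pow_mul]; ring
      _ ≤ c' * (t * s ^ n) := by gcongr
      _ ≤ r / 2 := by rw [hts, mul_one]; exact hc'r

/-- For small `a`, every family of maps near `powerMap a b d` is a squeezing extension of `Γ`, and
there is a ring which `Γ` throws outwards and this family inwards. -/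
theorem exists_forall_isSqueezingExtension {Γ : Set Poly} (hne : Γ.Nonempty) (hcpt : IsCompact Γ)
    (hG : IsPostcriticallyBounded (generated Γ)) {b : ℂ}
    (hb : b ∈ interior (smallestFilledJulia (generated Γ))) {d e : ℕ} (hd : 2 ≤ d) (he : 2 ≤ e)
    (hde : d + 1 ≤ e * (d - 1)) (hΓe : ∀ h ∈ Γ, e ≤ h.degree) :
    ∃ c : ℝ, 0 < c ∧ ∀ (a : ℂ) (ha : a ≠ 0), ‖a‖ < c → ∃ η > 0, η < ‖a‖ ∧
      ∃ r R M₁ M₂ : ℝ, M₁ < M₂ ∧ smallestFilledJulia (generated Γ) ⊆ Metric.closedBall b M₁ ∧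
        (∀ h ∈ Γ, ∀ z, M₁ < ‖z - b‖ → R < ‖h.eval z - b‖) ∧
        ∀ W ⊆ (powerMap a b d ha hd).coeffNhd η, IsSqueezingExtension Γ W b r R ∧
          ∀ g ∈ W, Set.MapsTo g.eval (Metric.ball b M₂) (Metric.closedBall b r) := by
  obtain ⟨κ, hκ, R₀, hgrow⟩ := exists_uniform_growth hcpt b e
  obtain ⟨ρ, hρ, hball⟩ := Metric.nhds_basis_closedBall.mem_iff.1
    (mem_interior_iff_mem_nhds.1 hb)
  set r := ρ / 3 with hr
  have hr0 : 0 < r := by positivity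
  have hr3 : 3 * r = ρ := by rw [hr]; ring
  set R₁ : ℝ := |R₀| + 2 / κ + 1 with hR₁
  have hκ2 : 0 < 2 / κ := by positivity
  have hR₁R₀ : R₀ ≤ R₁ := by linarith [le_abs_self R₀]
  have hR₁1 : 1 ≤ R₁ := by linarith [abs_nonneg R₀]
  have hR₁κ : 2 ≤ κ * R₁ := by
    have : 2 / κ ≤ R₁ := by linarith [abs_nonneg R₀]
    rwa [div_le_iff₀' hκ] at this
  have hexp : ∀ h ∈ Γ, ∀ z, R₁ < ‖z - b‖ → 3 / 2 * ‖z - b‖ ≤ ‖h.eval z - b‖ := by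
    intro h hh z hz
    refine le_trans ?_ (hgrow h hh (hΓe h hh) z (hR₁R₀.trans hz.le))
    have h1 : ‖z - b‖ ^ 2 ≤ ‖z - b‖ ^ e := pow_le_pow_right₀ (hR₁1.trans hz.le) he
    have h2 : κ * ‖z - b‖ ^ 2 ≤ κ * ‖z - b‖ ^ e := by gcongr
    have h3 : κ * R₁ ≤ κ * ‖z - b‖ := by gcongr
    nlinarith [norm_nonneg (z - b)]
  have hKR₁ := smallestFilledJulia_subset_closedBall hne (by linarith) hexp
  obtain ⟨c, hc, hscale⟩ := exists_scales hκ hr0 hR₁1 (norm_nonneg b) hd he hde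
  refine ⟨c, hc, fun a ha hac => ?_⟩
  have ha0 : 0 < ‖a‖ := norm_pos_iff.2 ha
  obtain ⟨R, M₁, M₂, hR₁R, hbR, haR, hM₁R₁, hM₁₂, hRM₁, haM₂⟩ := hscale ‖a‖ ha0 hac
  have hM₂1 : 1 ≤ M₂ := by linarith
  set B₁ : ℝ := (d + 1) * (‖b‖ + 1 + M₂) ^ d with hB₁
  set B₂ : ℝ := (d + 1) * (‖b‖ + 2) ^ d with hB₂
  have hB₁0 : 0 < B₁ := by positivity
  have hB₂0 : 0 < B₂ := by positivity
  have hB₂1 : 1 ≤ B₂ := by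
    have h1 : 1 ≤ (‖b‖ + 2) ^ d := one_le_pow₀ (by linarith [norm_nonneg b])
    have h2 : (0 : ℝ) ≤ d := Nat.cast_nonneg d
    nlinarith
  set η : ℝ := min (r / 2 / B₁) (‖a‖ / 4 / B₂) with hη
  have hη0 : 0 < η := by positivity
  have hη₁ : η * B₁ ≤ r / 2 := by
    rw [← le_div_iff₀ hB₁0]; exact min_le_left _ _
  have hη₂ : η * B₂ ≤ ‖a‖ / 4 := by
    rw [← le_div_iff₀ hB₂0]; exact min_le_right _ _
  refine ⟨η, hη0, by nlinarith, r, R, M₁, M₂, hM₁₂,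
    hKR₁.trans (Metric.closedBall_subset_closedBall hM₁R₁), fun h hh z hz => ?_, fun W hW => ?_⟩
  · refine hRM₁.trans_le (le_trans ?_
      (hgrow h hh (hΓe h hh) z (hR₁R₀.trans (hM₁R₁.trans hz.le))))
    exact mul_le_mul_of_nonneg_left (pow_le_pow_left₀ (by linarith) hz.le e) hκ.le
  · have hbounds := fun g (hg : g ∈ W) => coeffNhd_powerMap_bounds hM₂1 (r := r)
      (by rw [mul_right_comm]; linarith) (by rw [mul_right_comm]; linarith) haM₂ (hW hg)
    refine ⟨?_, fun g hg => (hbounds g hg).1⟩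
    exact
      { nonempty := hne
        r_pos := hr0
        norm_lt := hbR
        expand := by
          rintro h (hh | hh) z hz
          · exact hexp h hh z (hR₁R.trans_lt hz)
          · exact (hbounds h hh).2.1 R (hR₁1.trans hR₁R) haR z hz
        closedBall_subset := by rw [hr3]; exact hball
        critical := fun f hf => hG.planeCriticalValues_subset hf
        mapsTo := fun g hg => (hbounds g hg).1.mono_left
          (hKR₁.trans (Metric.closedBall_subset_ball (hM₁R₁.trans_lt hM₁₂)))
        critical_right := fun g hg => (hbounds g hg).2.2 }

end PolySemigroup

theorem lemma5p1 (Γ : Set PolySemigroup.Poly) (hne : Γ.Nonempty)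
    (hdeg : Γ ⊆ PolySemigroup.polyDegGeTwo) (hcpt : IsCompact Γ)
    (hG : PolySemigroup.IsPostcriticallyBounded (PolySemigroup.generated Γ))
    (b : ℂ)
    (hb : b ∈ interior (PolySemigroup.smallestFilledJulia (PolySemigroup.generated Γ)))
    (d : ℕ) (hd : 2 ≤ d) (hdd : ∀ h ∈ Γ, (d, h.degree) ≠ (2, 2)) :
    ∃ c : ℝ, 0 < c ∧ ∀ (a : ℂ) (ha : a ≠ 0), ‖a‖ < c →
      ∃ V : Set PolySemigroup.Poly,
        V ⊆ PolySemigroup.polyDegGeTwo ∧ IsCompact V ∧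
        V ∈ 𝓝[PolySemigroup.polyDegGeTwo] (PolySemigroup.powerMap a b d ha hd) ∧
        ∀ V' ⊆ V, V'.Nonempty →
          PolySemigroup.IsPostcriticallyBoundedDis (PolySemigroup.generated (Γ ∪ V')) ∧
          PolySemigroup.smallestFilledJulia (PolySemigroup.generated (Γ ∪ V')) =
            PolySemigroup.smallestFilledJulia (PolySemigroup.generated Γ) ∧
          (PolySemigroup.IsSemiHyperbolic (PolySemigroup.generated Γ) →
            PolySemigroup.IsSemiHyperbolic (PolySemigroup.generated (Γ ∪ V'))) ∧
          (PolySemigroup.IsHyperbolic (PolySemigroup.generated Γ) →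
            PolySemigroup.IsHyperbolic (PolySemigroup.generated (Γ ∪ V'))) := by
  -- The degree condition is used through a common lower bound `e` of the degrees in `Γ`.
  obtain ⟨e, he, hde, hΓe⟩ : ∃ e, 2 ≤ e ∧ d + 1 ≤ e * (d - 1) ∧
      ∀ h ∈ Γ, e ≤ PolySemigroup.Poly.degree h := by
    by_cases h2 : d = 2
    · subst h2
      refine ⟨3, by norm_num, by norm_num, fun h hh => ?_⟩
      have h3 : 2 ≤ h.degree := hdeg hh
      have h4 : h.degree ≠ 2 := fun h4 => hdd h hh (by rw [h4])
      omega
    · exact ⟨2, le_rfl, by omega, fun h hh => hdeg hh⟩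
  obtain ⟨c, hc, hmain⟩ :=
    PolySemigroup.exists_forall_isSqueezingExtension hne hcpt hG hb hd he hde hΓe
  refine ⟨c, hc, fun a ha hac => ?_⟩
  obtain ⟨η, hη, hηa, r, R, M₁, M₂, hM, hK, hΓM, hW⟩ := hmain a ha hac
  have hVdeg : (PolySemigroup.powerMap a b d ha hd).coeffNhd η ⊆ PolySemigroup.polyDegGeTwo := by
    intro g hg
    rw [PolySemigroup.polyDegGeTwo, Set.mem_ofPred_eq, hg.1, PolySemigroup.degree_powerMap]
    exact hd
  refine ⟨_, hVdeg, PolySemigroup.Poly.isCompact_coeffNhd _ ?_,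
    mem_nhdsWithin_of_mem_nhds (PolySemigroup.Poly.coeffNhd_mem_nhds _ hη), fun W hWV hWne => ?_⟩
  · rwa [PolySemigroup.coeff_powerMap]
  · obtain ⟨A, hWb⟩ := hW W hWV
    exact ⟨⟨A.isPostcriticallyBounded (Set.union_subset hdeg (hWV.trans hVdeg)),
      A.not_isPreconnected_juliaSet hWne hM hK hΓM hWb⟩, A.smallestFilledJulia_eq,
      A.isSemiHyperbolic, A.isHyperbolic⟩
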